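/- Consider one bosonic mode, i.e. $L^2(\mathbb R)$ with $\hat q$ multiplication by $x$, $\hat p=-i\,d/dx$, and displacement operators $\mathscr D(u)=\exp[i(u_2\hat q-u_1\hat p)]$, $u\in\mathbb R^2$. Put $$\sigma=\begin{pmatrix}0&1\\-1&0\end{pmatrix},\quad D_r=\begin{pmatrix}e^{r}&0\\0&e^{-r}\end{pmatrix},\quad O_\phi=\begin{pmatrix}\cos\phi&\sin\phi\\-\sin\phi&\cos\phi\end{pmatrix},\quad S_{r,\phi}=O_\phi D_rO_\phi^t .$$ For $\theta=(\beta,r,\phi,q,p)\in\mathbb R^5$ with $\beta>0$ there is exactly one density operator $\rho(\theta)$, the Gaussian state with displacement vector $\xi=(q,p)^t$ and covariance matrix $\Gamma=\coth(\beta/2)\,S_{r,\phi}S_{r,\phi}^t$, whose characteristic function is $$\operatorname{tr}[\mathscr D(u)\rho(\theta)]=\exp\!\left(-iu^t\sigma\xi-\tfrac14u^t\sigma^t\Gamma\sigma u\right)\qquad(u\in\mathbb R^2).$$ For two such states $\rho_0,\rho_1$ and every $s\in[0,1]$ the operator $\rho_0^s\rho_1^{1-s}$ is trace class with positive trace, and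 the minimum over $s\in[0,1]$ in $$Q(\rho_0,\rho_1)=\min_{s\in[0,1]}\operatorname{tr}\rho_0^s\rho_1^{1-s},\qquad D_{\rm QC}(\rho_0,\rho_1)=-\min_{s\in[0,1]}\log\operatorname{tr}\rho_0^s\rho_1^{1-s}$$ is attained. The quantum Chernoff metric on these states, i.e. the quadratic form $ds^2_{\rm QC}=d\theta\,\boldsymbol g\,d\theta^t$ ($\boldsymbol g$ symmetric, depending on $\theta$) with $$D_{\rm QC}(\rho(\theta),\rho(\theta+d\theta))=ds^2_{\rm QC}+o(|d\theta|^2),\qquad 1-Q(\rho(\theta),\rho(\theta+d\theta))=ds^2_{\rm QC}+o(|d\theta|^2)\qquad(d\theta\to0),$$ exists at every such $\theta$ and is $$ds^2_{\rm QC}=\frac{d\beta^2}{32\sinh^2\frac\beta2}+\frac{dr^2+\sinh^2(2r)\,d\phi^2}{2}+\frac{e^{-2r}dq_\phi^2+e^{2r}dp_\phi^2}{2}\tanh\frac\beta4,$$ where $(dq_\phi,dp_\phi)=(dq,dp)\,O_\phi$. The corresponding (unnormalized) quantum Jeffreys prior density with respect to $d\beta\,dr\,d\phi\,dq\,dp$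 is $$\sqrt{|\det\boldsymbol g|}=\frac{1}{16\sqrt2}\,\frac{\tanh(\beta/4)}{\sinh(\beta/2)}\,|\sinh 2r|$$ (with $|\sinh 2r|=\sinh 2r$ for $r\ge0$). -/

import Mathlib

open MeasureTheory Filter Topology Asymptotics
open scoped Matrix ENNReal

noncomputable section

namespace QuantumChernoff

/-! ### Traces, powers and the quantum Chernoff information -/

section Trace

/-- `T` has trace `t`: in every orthonormal basis the diagonal of `T` sums (unconditionally) to `t`.
A bounded operator satisfies this for some `t` if and only if it is trace class, and then `t` is
its trace. -/
def HasTrace {H : Type} [NormedAddCommGroup H] [InnerProductSpace ℂ H]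
    (T : H →L[ℂ] H) (t : ℂ) : Prop :=
  ∀ (ι : Type) (b : HilbertBasis ι ℂ H), HasSum (fun i => inner ℂ (b i) (T (b i))) t

open Classical in
/-- The trace of a trace class operator (and `0` for other operators). -/
def opTrace {H : Type} [NormedAddCommGroup H] [InnerProductSpace ℂ H] (T : H →L[ℂ] H) : ℂ :=
  if h : ∃ t, HasTrace T t then h.choose else 0

/-- A density operator: positive, with trace one. -/
structure IsDensityOperator {H : Type} [NormedAddCommGroup H] [InnerProductSpace ℂ H]
    [CompleteSpace H] (ρ : H →L[ℂ] H) : Prop where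
  isPositive : ρ.IsPositive
  hasTrace : HasTrace ρ 1

/-- `ρ₀ ^ s * ρ₁ ^ (1 - s)`, the powers being those of the continuous functional calculus. -/
def chernoffProduct {H : Type} [NormedAddCommGroup H] [InnerProductSpace ℂ H] [CompleteSpace H]
    (ρ₀ ρ₁ : H →L[ℂ] H) (s : ℝ) : H →L[ℂ] H :=
  CFC.rpow ρ₀ s * CFC.rpow ρ₁ (1 - s)

/-- `Q_s = tr (ρ₀ ^ s * ρ₁ ^ (1 - s))`, a real number for positive operators. -/
def chernoffTrace {H : Type} [NormedAddCommGroup H] [InnerProductSpace ℂ H] [CompleteSpace H]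
    (ρ₀ ρ₁ : H →L[ℂ] H) (s : ℝ) : ℝ :=
  (opTrace (chernoffProduct ρ₀ ρ₁ s)).re

/-- `Q = min_{s ∈ [0,1]} tr (ρ₀ ^ s * ρ₁ ^ (1 - s))`. -/
def chernoffQ {H : Type} [NormedAddCommGroup H] [InnerProductSpace ℂ H] [CompleteSpace H]
    (ρ₀ ρ₁ : H →L[ℂ] H) : ℝ :=
  sInf ((fun s => chernoffTrace ρ₀ ρ₁ s) '' Set.Icc (0 : ℝ) 1)

/-- The quantum Chernoff information `D = - min_{s ∈ [0,1]} log tr (ρ₀ ^ s * ρ₁ ^ (1 - s))`. -/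
def chernoffInformation {H : Type} [NormedAddCommGroup H] [InnerProductSpace ℂ H]
    [CompleteSpace H] (ρ₀ ρ₁ : H →L[ℂ] H) : ℝ :=
  - sInf ((fun s => Real.log (chernoffTrace ρ₀ ρ₁ s)) '' Set.Icc (0 : ℝ) 1)

end Trace

/-! ### Metrics induced by distinguishability measures -/

/-- `g` is the metric tensor, at the point `θ` of a coordinate domain in `ℝⁿ`, induced by the
distinguishability measure `D`: it is symmetric and `D(θ, θ + dθ) = dθᵗ g dθ` up to higher order
terms in `dθ`. (There is at most one such `g`.) -/
structure IsInducedMetric {n : ℕ} (D : (Fin n → ℝ) → (Fin n → ℝ) → ℝ) (θ : Fin n → ℝ)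
    (g : Matrix (Fin n) (Fin n) ℝ) : Prop where
  isSymm : g.IsSymm
  expansion : (fun h : Fin n → ℝ => D θ (θ + h) - h ⬝ᵥ (g *ᵥ h)) =o[𝓝 0] fun h => ‖h‖ ^ 2

/-- The unnormalized Jeffreys prior density of a metric tensor: the density of its volume
element. -/
def jeffreysDensity {n : ℕ} (g : Matrix (Fin n) (Fin n) ℝ) : ℝ := Real.sqrt |g.det|

/-! ### The displacement operators of one mode -/

/-- The state space of one mode in the Schrödinger representation: `q̂` is multiplication by `x`
and `p̂ = -i d/dx`. -/
abbrev ModeSpace : Type := Lp ℂ 2 (volume : Measure ℝ)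

/-- The phase in the displacement operator. -/
def weylPhase (u : Fin 2 → ℝ) (x : ℝ) : ℂ :=
  Complex.exp (((u 1 * x - u 0 * u 1 / 2 : ℝ) : ℂ) * Complex.I)

/-- The action of `exp (i (u₂ q̂ - u₁ p̂))` on wave functions:
`ψ(x) ↦ exp (i (u₂ x - u₁ u₂ / 2)) ψ(x - u₁)`. -/
def weylFun (u : Fin 2 → ℝ) (ψ : ℝ → ℂ) (x : ℝ) : ℂ := weylPhase u x * ψ (x - u 0)

/-- The displacements along a fixed direction form a one-parameter group. -/
theorem weylFun_add_smul (u : Fin 2 → ℝ) (s t : ℝ) (ψ : ℝ → ℂ) :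
    weylFun (s • u) (weylFun (t • u) ψ) = weylFun ((s + t) • u) ψ := by
  funext x
  simp only [weylFun, weylPhase, Pi.smul_apply, smul_eq_mul]
  rw [← mul_assoc, ← Complex.exp_add]
  congr 2
  · push_cast
    ring
  · ring

/-- The generator of this group is `i (u₂ q̂ - u₁ p̂)`. -/
theorem hasDerivAt_weylFun (u : Fin 2 → ℝ) (ψ : ℝ → ℂ) (x : ℝ) (c : ℂ)
    (hψ : HasDerivAt ψ c x) :
    HasDerivAt (fun t : ℝ => weylFun (t • u) ψ x)
      (Complex.I * ((u 1 : ℂ) * ((x : ℂ) * ψ x) - (u 0 : ℂ) * (-Complex.I * c))) 0 := by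
  have h1 : HasDerivAt (fun t : ℝ => t * u 1 * x - t * u 0 * (t * u 1) / 2) (u 1 * x) 0 := by
    have h := (((hasDerivAt_id (0 : ℝ)).mul_const (u 1)).mul_const x).sub
      ((((hasDerivAt_id (0 : ℝ)).mul_const (u 0)).mul
        ((hasDerivAt_id (0 : ℝ)).mul_const (u 1))).div_const 2)
    refine (h.congr_deriv ?_).congr_of_eventuallyEq (Eventually.of_forall fun t => ?_) <;> simp
  have h2 : HasDerivAt (fun t : ℝ => weylPhase (t • u) x) (Complex.I * ((u 1 : ℂ) * x)) 0 := by
    have h := (h1.ofReal_comp.mul_const Complex.I).cexp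
    refine (h.congr_deriv ?_).congr_of_eventuallyEq (Eventually.of_forall fun t => ?_)
    · simp [mul_comm]
    · simp [weylPhase]
  have h3 : HasDerivAt (fun t : ℝ => ψ (x - t * u 0)) (-(u 0 : ℂ) * c) 0 := by
    have h0 : HasDerivAt (fun t : ℝ => x - t * u 0) (-(u 0)) 0 := by
      simpa using ((hasDerivAt_id (0 : ℝ)).mul_const (u 0)).const_sub x
    have hψ' : HasDerivAt ψ c (x - 0 * u 0) := by simpa using hψ
    refine ((hψ'.scomp (0 : ℝ) h0).congr_deriv ?_).congr_of_eventuallyEq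
      (Eventually.of_forall fun t => rfl)
    simp
  refine (h2.mul h3).congr_deriv ?_
  have hI : Complex.I * Complex.I = -1 := Complex.I_mul_I
  simp only [weylPhase, zero_smul, Pi.zero_apply, zero_mul, sub_zero, zero_div,
    Complex.ofReal_zero, Complex.exp_zero]
  linear_combination (-(u 0 : ℂ) * c) * hI

theorem norm_weylPhase (u : Fin 2 → ℝ) (x : ℝ) : ‖weylPhase u x‖ = 1 := by
  rw [weylPhase, Complex.norm_exp_ofReal_mul_I]

theorem continuous_weylPhase (u : Fin 2 → ℝ) : Continuous (weylPhase u) := by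
  unfold weylPhase
  fun_prop

theorem measurePreserving_sub (a : ℝ) :
    MeasurePreserving (fun x : ℝ => x - a) volume volume :=
  measurePreserving_sub_right volume a

theorem eLpNorm_weylFun (u : Fin 2 → ℝ) (ψ : ModeSpace) :
    eLpNorm (weylFun u ψ) 2 volume = eLpNorm ψ 2 volume := by
  have h1 : eLpNorm (weylFun u ψ) 2 volume
      = eLpNorm (fun x => ψ (x - u 0)) 2 volume := by
    apply eLpNorm_congr_norm_ae
    exact Eventually.of_forall fun x => by simp [weylFun, norm_weylPhase]
  rw [h1]
  exact eLpNorm_comp_measurePreserving (Lp.aestronglyMeasurable ψ) (measurePreserving_sub (u 0))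

theorem memLp_weylFun (u : Fin 2 → ℝ) (ψ : ModeSpace) : MemLp (weylFun u ψ) 2 volume := by
  refine ⟨?_, ?_⟩
  · exact (continuous_weylPhase u).aestronglyMeasurable.mul
      ((Lp.aestronglyMeasurable ψ).comp_measurePreserving (measurePreserving_sub (u 0)))
  · rw [eLpNorm_weylFun]
    exact Lp.eLpNorm_lt_top ψ

/-- The displacement operator `D(u) = exp (i (u₂ q̂ - u₁ p̂))` on `L²(ℝ)`, in the form
`(D(u) ψ)(x) = exp (i (u₂ x - u₁ u₂ / 2)) ψ(x - u₁)`. -/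
def displacement (u : Fin 2 → ℝ) : ModeSpace →L[ℂ] ModeSpace :=
  LinearMap.mkContinuous
    { toFun := fun ψ => (memLp_weylFun u ψ).toLp (weylFun u ψ)
      map_add' := fun ψ χ => by
        rw [← MemLp.toLp_add]
        apply MemLp.toLp_congr
        have h := (measurePreserving_sub (u 0)).quasiMeasurePreserving.ae (Lp.coeFn_add ψ χ)
        filter_upwards [h] with x hx
        simp only [weylFun, Pi.add_apply] at hx ⊢
        rw [hx, mul_add]
      map_smul' := fun c ψ => by
        rw [RingHom.id_apply, ← MemLp.toLp_const_smul]
        apply MemLp.toLp_congr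
        have h := (measurePreserving_sub (u 0)).quasiMeasurePreserving.ae (Lp.coeFn_smul c ψ)
        filter_upwards [h] with x hx
        simp only [weylFun, Pi.smul_apply, smul_eq_mul] at hx ⊢
        rw [hx]
        ring }
    1
    (fun ψ => by
      change ‖(memLp_weylFun u ψ).toLp (weylFun u ψ)‖ ≤ 1 * ‖ψ‖
      rw [Lp.norm_toLp, eLpNorm_weylFun, one_mul, Lp.norm_def])

/-! ### Gaussian states of one mode -/

/-- The symplectic matrix. -/
def sympl : Matrix (Fin 2) (Fin 2) ℝ := !![0, 1; -1, 0]

/-- `ρ` is the Gaussian state with displacement vector `ξ` and covariance matrix `Γ`: a density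
operator with characteristic function
`tr (D(u) ρ) = exp (- i uᵗ σ ξ - (1/4) uᵗ σᵗ Γ σ u)`. -/
structure IsGaussianState (ρ : ModeSpace →L[ℂ] ModeSpace) (ξ : Fin 2 → ℝ)
    (Γ : Matrix (Fin 2) (Fin 2) ℝ) : Prop where
  isDensityOperator : IsDensityOperator ρ
  charFun : ∀ u : Fin 2 → ℝ, HasTrace (displacement u * ρ)
    (Complex.exp (-Complex.I * ((u ⬝ᵥ (sympl *ᵥ ξ) : ℝ) : ℂ)
      - ((u ⬝ᵥ ((symplᵀ * Γ * sympl) *ᵥ u) : ℝ) : ℂ) / 4))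

/-- `O_φ`. -/
def rotMat (φ : ℝ) : Matrix (Fin 2) (Fin 2) ℝ :=
  !![Real.cos φ, Real.sin φ; -Real.sin φ, Real.cos φ]

/-- `D_r`. -/
def squeezeDiag (r : ℝ) : Matrix (Fin 2) (Fin 2) ℝ := !![Real.exp r, 0; 0, Real.exp (-r)]

/-- `S_{r,φ} = O_φ D_r O_φᵗ`. -/
def squeezeMat (r φ : ℝ) : Matrix (Fin 2) (Fin 2) ℝ := rotMat φ * squeezeDiag r * (rotMat φ)ᵀ

/-- The covariance matrix `Γ = coth (β/2) S_{r,φ} S_{r,φ}ᵗ` of the squeezed thermal state of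
inverse temperature `β`. -/
def covMat (β r φ : ℝ) : Matrix (Fin 2) (Fin 2) ℝ :=
  (Real.tanh (β / 2))⁻¹ • (squeezeMat r φ * (squeezeMat r φ)ᵀ)

/-- A point `θ = (β, r, φ, q, p)` of the parameter domain labels the state `ρ`: the Gaussian state
with displacement vector `(q, p)` and covariance matrix `coth (β/2) S_{r,φ} S_{r,φ}ᵗ`. -/
def IsGaussianStateAt (ρ : ModeSpace →L[ℂ] ModeSpace) (θ : Fin 5 → ℝ) : Prop :=
  IsGaussianState ρ ![θ 3, θ 4] (covMat (θ 0) (θ 1) (θ 2))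

/-- The row vector `(dq_φ, dp_φ) = (dq, dp) O_φ`. -/
def rotatedDisplacement (φ dq dp : ℝ) : Fin 2 → ℝ := ![dq, dp] ᵥ* rotMat φ

/-- The line element
`dβ²/(32 sinh²(β/2)) + (dr² + sinh²(2r) dφ²)/2 + (e^{-2r} dq_φ² + e^{2r} dp_φ²) tanh(β/4)/2`
at `θ = (β, r, φ, q, p)` in the direction `h = (dβ, dr, dφ, dq, dp)`. -/
def gaussianLineElement (θ h : Fin 5 → ℝ) : ℝ :=
  (h 0) ^ 2 / (32 * Real.sinh (θ 0 / 2) ^ 2)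
    + ((h 1) ^ 2 + Real.sinh (2 * θ 1) ^ 2 * (h 2) ^ 2) / 2
    + (Real.exp (-2 * θ 1) * (rotatedDisplacement (θ 2) (h 3) (h 4) 0) ^ 2
        + Real.exp (2 * θ 1) * (rotatedDisplacement (θ 2) (h 3) (h 4) 1) ^ 2)
      * Real.tanh (θ 0 / 4) / 2

end QuantumChernoff

end

open QuantumChernoff

/-!
The states are handled through explicit integral kernels. Squeezing and displacing the oscillator
semigroup `exp (-t (n̂ + 1/2))` multiplies the Mehler kernel by a phase and changes its variables
(`ModeFrame.kernel`), and Gaussian integration gives the semigroup law (`ModeFrame.op_mul_op`), so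
that `2 sinh (β / 2)` times the member at time `β` is a density operator. Traces of products of two
such operators are double integrals of their kernels, by Parseval's identity in one variable
(`hasTrace_kernelOp_mul`); here they are Gaussian integrals. They give the characteristic function
(`ModeFrame.hasTrace_displacement_mul_state`) and the overlaps (`ModeFrame.hasTrace_op_mul_op`).

A density operator is determined by its characteristic function
(`IsDensityOperator.eq_of_charFun`): writing `ρ = R * R` and `ψᵢ = R bᵢ` for an orthonormal basis
`b`, the characteristic function is, for each shift `v` and up to a phase, the Fourier transform of
the integrable correlation density `∑ᵢ conj (ψᵢ x) ψᵢ (x - v)`, and these densities determine the matrix elements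
of `ρ`. Hence the states of the semigroup are the only ones with the given characteristic functions.

A positive contraction semigroup consists of the powers of its members
(`rpow_of_contraction_semigroup`), so `ρ₀ ^ s * ρ₁ ^ (1 - s)` is again a product of two members of
such semigroups, and its trace is the explicit continuous function `ModeFrame.chernoffValue` of
`s`, which equals `1` at both ends of `[0, 1]`. By compactness the minimum is attained, and
`Q = exp (-D)`.

Minus the logarithm of that trace is a sum of three nonnegative terms
(`ModeFrame.neg_log_chernoffValue`): the Jensen gap of `log (sinh (β / 2))` for the two inverse
temperatures, a term in the mismatch of the two squeezing matrices, and a term in the difference of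
the two displacements. To second order each of them is largest at `s = 1 / 2`. Accordingly the
information lies between its value at `s = 1 / 2` and a bound uniform in `s`, with the same
expansion (`ModeFrame.le_neg_log_chernoffValue_half`, `ModeFrame.neg_log_chernoffValue_le`).
Comparing the two bounds gives its line element, and `1 - exp (-D)` has the
same one. The determinant of the metric is that of a block diagonal matrix, whose displacement block
is `tanh (β / 4) / 2` times a matrix of determinant one.
-/

namespace QuantumChernoff

/-! ### Traces in arbitrary orthonormal bases -/

theorem HasTrace.unique {H : Type} [NormedAddCommGroup H] [InnerProductSpace ℂ H] [CompleteSpace H]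
    {T : H →L[ℂ] H} {s t : ℂ} (hs : HasTrace T s) (ht : HasTrace T t) : s = t := by
  obtain ⟨w, b, -⟩ := exists_hilbertBasis ℂ H
  exact (hs w b).unique (ht w b)

theorem HasTrace.opTrace_eq {H : Type} [NormedAddCommGroup H] [InnerProductSpace ℂ H]
    [CompleteSpace H] {T : H →L[ℂ] H} {t : ℂ} (h : HasTrace T t) : opTrace T = t := by
  have hex : ∃ t, HasTrace T t := ⟨t, h⟩
  rw [opTrace, dif_pos hex]
  exact hex.choose_spec.unique h

theorem HasTrace.smul {H : Type} [NormedAddCommGroup H] [InnerProductSpace ℂ H]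
    {T : H →L[ℂ] H} {t : ℂ} (h : HasTrace T t) (c : ℂ) : HasTrace (c • T) (c * t) := by
  intro ι b
  simpa [inner_smul_right] using (h ι b).mul_left c

/-- Orthonormal families in a separable space are countable: the balls of radius `1/2` around
their members are disjoint. -/
theorem countable_of_hilbertBasis {H : Type} [NormedAddCommGroup H] [InnerProductSpace ℂ H]
    [TopologicalSpace.SeparableSpace H] {ι : Type} (b : HilbertBasis ι ℂ H) : Countable ι := by
  refine Pairwise.countable_of_isOpen_disjoint (s := fun i => Metric.ball (b i) (1 / 2)) ?_
    (fun i => Metric.isOpen_ball) (fun i => ⟨b i, Metric.mem_ball_self (by norm_num)⟩)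
  intro i j hij
  apply Metric.ball_disjoint_ball
  have h1 : ‖b i - b j‖ ^ 2 = 2 := by
    rw [@norm_sub_sq ℂ, b.orthonormal.1 i, b.orthonormal.1 j, b.orthonormal.2 hij]
    norm_num
  rw [dist_eq_norm]
  nlinarith [norm_nonneg (b i - b j)]

/-! ### Integral operators with dominated kernels -/

/-- A continuous kernel on `ℝ × ℝ` bounded by a product `g x * h y` of square integrable
functions. -/
def IsDominatedBy (k : ℝ → ℝ → ℂ) (g h : ℝ → ℝ) : Prop :=
  Continuous (Function.uncurry k) ∧ MemLp g 2 volume ∧ MemLp h 2 volume ∧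
    ∀ x y, ‖k x y‖ ≤ g x * h y

namespace IsDominatedBy

variable {k l : ℝ → ℝ → ℂ} {g h g' h' : ℝ → ℝ}

theorem continuous_right (hk : IsDominatedBy k g h) (x : ℝ) : Continuous (k x) :=
  hk.1.comp (by fun_prop : Continuous fun y : ℝ => (x, y))

theorem swap (hk : IsDominatedBy k g h) :
    IsDominatedBy (fun x y => starRingEnd ℂ (k y x)) h g := by
  refine ⟨?_, hk.2.2.1, hk.2.1, fun x y => ?_⟩
  · exact Complex.continuous_conj.comp (hk.1.comp continuous_swap)
  · rw [RCLike.norm_conj, mul_comm]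
    exact hk.2.2.2 y x

theorem memLp_right (hk : IsDominatedBy k g h) (x : ℝ) : MemLp (k x) 2 volume :=
  MemLp.of_le_mul hk.2.2.1 (hk.continuous_right x).aestronglyMeasurable
    (c := |g x|) (Eventually.of_forall fun y =>
      (hk.2.2.2 x y).trans ((le_abs_self _).trans (by rw [abs_mul]; rfl)))

theorem integrable_mul_right (hk : IsDominatedBy k g h) (ψ : ModeSpace) (x : ℝ) :
    Integrable (fun y => k x y * ψ y) volume :=
  (hk.memLp_right x).integrable_mul (Lp.memLp ψ)

theorem norm_integral_le (hk : IsDominatedBy k g h) (ψ : ModeSpace) (x : ℝ) :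
    ‖∫ y, k x y * ψ y‖ ≤ (∫ y, |h y| * ‖ψ y‖) * |g x| := by
  rw [← integral_mul_const]
  refine norm_integral_le_of_norm_le ?_ (Eventually.of_forall fun y => ?_)
  · exact (hk.2.2.1.abs.integrable_mul (Lp.memLp ψ).norm).mul_const _
  · rw [norm_mul]
    have := (hk.2.2.2 x y).trans ((le_abs_self _).trans (abs_mul _ _).le)
    calc ‖k x y‖ * ‖ψ y‖ ≤ (|g x| * |h y|) * ‖ψ y‖ := by gcongr
      _ = _ := by ring

theorem memLp_integral (hk : IsDominatedBy k g h) (ψ : ModeSpace) :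
    MemLp (fun x => ∫ y, k x y * ψ y) 2 volume := by
  refine MemLp.of_le_mul hk.2.1 ?_ (Eventually.of_forall fun x => hk.norm_integral_le ψ x)
  refine StronglyMeasurable.aestronglyMeasurable ?_
  refine StronglyMeasurable.integral_prod_right (f := fun x y => k x y * ψ y) ?_
  exact hk.1.stronglyMeasurable.mul ((Lp.stronglyMeasurable ψ).comp_measurable measurable_snd)

end IsDominatedBy

theorem eLpNorm_toReal_sq {f : ℝ → ℂ} (hf : MemLp f 2 volume) :
    (eLpNorm f 2 volume).toReal ^ 2 = ∫ x, ‖f x‖ ^ 2 := by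
  rw [hf.eLpNorm_eq_integral_rpow_norm two_ne_zero ENNReal.ofNat_ne_top,
    ENNReal.toReal_ofReal (by positivity), ← Real.rpow_natCast, ← Real.rpow_mul (by positivity)]
  simp

theorem norm_sq_eq_integral (ψ : ModeSpace) : ‖ψ‖ ^ 2 = ∫ x, ‖ψ x‖ ^ 2 := by
  rw [Lp.norm_def, eLpNorm_toReal_sq (Lp.memLp ψ)]

/-- Cauchy-Schwarz inequality in the form used to bound integral operators. -/
theorem integral_abs_mul_norm_sq_le {h : ℝ → ℝ} (hh : MemLp h 2 volume) (ψ : ModeSpace) :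
    (∫ y, |h y| * ‖ψ y‖) ^ 2 ≤ (∫ y, h y ^ 2) * ‖ψ‖ ^ 2 := by
  have h1 := integral_mul_le_Lp_mul_Lq_of_nonneg (μ := volume) (f := fun y => |h y|)
    (g := fun y => ‖ψ y‖) Real.HolderConjugate.two_two
    (Eventually.of_forall fun _ => abs_nonneg _) (Eventually.of_forall fun _ => norm_nonneg _)
    (by rw [ENNReal.ofReal_ofNat]; exact hh.abs) (by simpa using (Lp.memLp ψ).norm)
  have h0 : 0 ≤ ∫ y, |h y| * ‖ψ y‖ := integral_nonneg fun _ => by positivity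
  rw [norm_sq_eq_integral]
  calc _ ≤ _ := pow_le_pow_left₀ h0 h1 2
    _ = _ := by
      rw [mul_pow, ← Real.sqrt_eq_rpow, ← Real.sqrt_eq_rpow, Real.sq_sqrt, Real.sq_sqrt]
      · simp
      · exact integral_nonneg fun _ => by positivity
      · exact integral_nonneg fun _ => by positivity

theorem IsDominatedBy.norm_toLp_le {k : ℝ → ℝ → ℂ} {g h : ℝ → ℝ} (hk : IsDominatedBy k g h)
    (ψ : ModeSpace) :
    ‖(hk.memLp_integral ψ).toLp _‖ ≤ √((∫ x, g x ^ 2) * ∫ y, h y ^ 2) * ‖ψ‖ := by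
  have h0 : 0 ≤ ∫ y, h y ^ 2 := integral_nonneg fun _ => by positivity
  have h0' : 0 ≤ ∫ y, g y ^ 2 := integral_nonneg fun _ => by positivity
  refine abs_le_of_sq_le_sq' ?_ (by positivity) |>.2
  rw [Lp.norm_toLp, eLpNorm_toReal_sq (hk.memLp_integral ψ), mul_pow, Real.sq_sqrt (by positivity)]
  calc ∫ x, ‖∫ y, k x y * ψ y‖ ^ 2 ≤ ∫ x, (∫ y, |h y| * ‖ψ y‖) ^ 2 * g x ^ 2 := by
        refine integral_mono_of_nonneg (Eventually.of_forall fun _ => by positivity)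
          (hk.2.1.integrable_sq.const_mul _) (Eventually.of_forall fun x => ?_)
        have := pow_le_pow_left₀ (norm_nonneg _) (hk.norm_integral_le ψ x) 2
        simpa [mul_pow] using this
    _ = (∫ y, |h y| * ‖ψ y‖) ^ 2 * ∫ x, g x ^ 2 := integral_const_mul _ _
    _ ≤ ((∫ y, h y ^ 2) * ‖ψ‖ ^ 2) * ∫ x, g x ^ 2 := by
        gcongr
        exact integral_abs_mul_norm_sq_le hk.2.2.1 ψ
    _ = _ := by ring

/-- The integral operator `ψ ↦ (x ↦ ∫ k x y * ψ y dy)` on `L²(ℝ)`. -/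
noncomputable def kernelOp {k : ℝ → ℝ → ℂ} {g h : ℝ → ℝ} (hk : IsDominatedBy k g h) :
    ModeSpace →L[ℂ] ModeSpace :=
  LinearMap.mkContinuous
    { toFun := fun ψ => (hk.memLp_integral ψ).toLp _
      map_add' := fun ψ χ => by
        rw [← MemLp.toLp_add]
        apply MemLp.toLp_congr
        refine Eventually.of_forall fun x => ?_
        simp only [Pi.add_apply]
        rw [← integral_add (hk.integrable_mul_right ψ x) (hk.integrable_mul_right χ x)]
        apply integral_congr_ae
        filter_upwards [Lp.coeFn_add ψ χ] with y hy
        rw [hy, Pi.add_apply, mul_add]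
      map_smul' := fun c ψ => by
        rw [RingHom.id_apply, ← MemLp.toLp_const_smul]
        apply MemLp.toLp_congr
        refine Eventually.of_forall fun x => ?_
        simp only [Pi.smul_apply, smul_eq_mul]
        rw [← integral_const_mul]
        apply integral_congr_ae
        filter_upwards [Lp.coeFn_smul c ψ] with y hy
        rw [hy, Pi.smul_apply, smul_eq_mul]
        ring }
    (√((∫ x, g x ^ 2) * ∫ y, h y ^ 2)) hk.norm_toLp_le

section kernelOp

variable {k l : ℝ → ℝ → ℂ} {g h g' h' : ℝ → ℝ}

theorem kernelOp_ae (hk : IsDominatedBy k g h) (ψ : ModeSpace) :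
    kernelOp hk ψ =ᵐ[volume] fun x => ∫ y, k x y * ψ y :=
  MemLp.coeFn_toLp (hk.memLp_integral ψ)

theorem norm_kernelOp_le (hk : IsDominatedBy k g h) :
    ‖kernelOp hk‖ ≤ √((∫ x, g x ^ 2) * ∫ y, h y ^ 2) :=
  LinearMap.mkContinuous_norm_le _ (Real.sqrt_nonneg _) _

theorem kernelOp_congr (hk : IsDominatedBy k g h) (hl : IsDominatedBy l g' h')
    (hkl : ∀ x y, k x y = l x y) : kernelOp hk = kernelOp hl := by
  ext1 ψ
  apply Lp.ext
  filter_upwards [kernelOp_ae hk ψ, kernelOp_ae hl ψ] with x hx hx'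
  rw [hx, hx']
  simp only [hkl]

/-- The Fubini integrability underlying adjoints and compositions of integral operators. -/
theorem IsDominatedBy.integrable_prod (hk : IsDominatedBy k g h) {φ ψ : ℝ → ℂ}
    (hφ : MemLp φ 2 volume) (hψ : MemLp ψ 2 volume) :
    Integrable (fun z : ℝ × ℝ => φ z.1 * k z.1 z.2 * ψ z.2) (volume.prod volume) := by
  have h1 : Integrable (fun z : ℝ × ℝ => (‖φ z.1‖ * |g z.1|) * (|h z.2| * ‖ψ z.2‖))
      (volume.prod volume) :=
    Integrable.mul_prod (hφ.norm.integrable_mul hk.2.1.abs) (hk.2.2.1.abs.integrable_mul hψ.norm)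
  refine h1.mono' ?_ (Eventually.of_forall fun z => ?_)
  · exact (hφ.1.comp_fst.mul hk.1.aestronglyMeasurable).mul hψ.1.comp_snd
  · rw [norm_mul, norm_mul]
    have := (hk.2.2.2 z.1 z.2).trans ((le_abs_self _).trans (abs_mul _ _).le)
    calc _ ≤ ‖φ z.1‖ * (|g z.1| * |h z.2|) * ‖ψ z.2‖ := by gcongr
      _ = _ := by ring

theorem inner_kernelOp (hk : IsDominatedBy k g h) (φ ψ : ModeSpace) :
    inner ℂ φ (kernelOp hk ψ) = ∫ x, ∫ y, starRingEnd ℂ (φ x) * k x y * ψ y := by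
  rw [L2.inner_def]
  apply integral_congr_ae
  filter_upwards [kernelOp_ae hk ψ] with x hx
  rw [hx, RCLike.inner_apply, mul_comm, ← integral_const_mul]
  simp only [mul_assoc]

theorem memLp_conj {φ : ℝ → ℂ} (hφ : MemLp φ 2 volume) :
    MemLp (fun x => starRingEnd ℂ (φ x)) 2 volume := hφ.star

/-- The adjoint of an integral operator has the conjugate transposed kernel. -/
theorem star_kernelOp (hk : IsDominatedBy k g h) : star (kernelOp hk) = kernelOp hk.swap := by
  rw [ContinuousLinearMap.star_eq_adjoint]
  symm
  rw [ContinuousLinearMap.eq_adjoint_iff]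
  intro φ ψ
  rw [← inner_conj_symm, inner_kernelOp, inner_kernelOp]
  rw [integral_integral_swap (f := fun x y => starRingEnd ℂ (φ x) * k x y * ψ y)
    (hk.integrable_prod (memLp_conj (Lp.memLp φ)) (Lp.memLp ψ)), ← integral_conj]
  refine integral_congr_ae (Eventually.of_forall fun y => ?_)
  dsimp only
  rw [← integral_conj]
  refine integral_congr_ae (Eventually.of_forall fun x => ?_)
  simp only [map_mul, Complex.conj_conj]
  ring

/-- Composition of integral operators. -/
theorem kernelOp_mul (hk : IsDominatedBy k g h) (hl : IsDominatedBy l g' h')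
    {m : ℝ → ℝ → ℂ} {g'' h'' : ℝ → ℝ} (hm : IsDominatedBy m g'' h'')
    (hklm : ∀ x y, ∫ z, k x z * l z y = m x y) :
    kernelOp hk * kernelOp hl = kernelOp hm := by
  ext1 ψ
  apply Lp.ext
  rw [mul_apply_eq_comp]
  filter_upwards [kernelOp_ae hk (kernelOp hl ψ), kernelOp_ae hm ψ] with x hx hx'
  rw [hx, hx']
  have h1 : ∫ z, k x z * kernelOp hl ψ z = ∫ z, ∫ y, k x z * l z y * ψ y := by
    apply integral_congr_ae
    filter_upwards [kernelOp_ae hl ψ] with z hz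
    rw [hz, ← integral_const_mul]
    simp only [mul_assoc]
  rw [h1, integral_integral_swap (f := fun z y => k x z * l z y * ψ y)
    (hl.integrable_prod (hk.memLp_right x) (Lp.memLp ψ))]
  refine integral_congr_ae (Eventually.of_forall fun y => ?_)
  dsimp only
  rw [integral_mul_const, hklm]

end kernelOp

/-! ### The trace formula for products of integral operators -/

section trace

variable {k l : ℝ → ℝ → ℂ} {g h g' h' : ℝ → ℝ}

/-- The vector `conj (k x ·)`, whose inner product with `ψ` is the value at `x` of the integral
operator applied to `ψ`. -/
noncomputable def kernelRow (hk : IsDominatedBy k g h) (x : ℝ) : ModeSpace :=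
  (memLp_conj (hk.memLp_right x)).toLp _

theorem inner_kernelRow (hk : IsDominatedBy k g h) (x : ℝ) (ψ : ModeSpace) :
    inner ℂ (kernelRow hk x) ψ = ∫ y, k x y * ψ y := by
  rw [L2.inner_def]
  apply integral_congr_ae
  filter_upwards [MemLp.coeFn_toLp (memLp_conj (hk.memLp_right x))] with y hy
  rw [RCLike.inner_apply, kernelRow, hy, Complex.conj_conj, mul_comm]

theorem inner_kernelRow_kernelRow (hk : IsDominatedBy k g h) (hl : IsDominatedBy l g' h')
    (x : ℝ) :
    inner ℂ (kernelRow hl x) (kernelRow hk x) = ∫ y, starRingEnd ℂ (k x y) * l x y := by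
  rw [inner_kernelRow]
  apply integral_congr_ae
  filter_upwards [MemLp.coeFn_toLp (memLp_conj (hk.memLp_right x))] with y hy
  rw [kernelRow, hy, mul_comm]

theorem norm_kernelRow_sq_le (hk : IsDominatedBy k g h) (x : ℝ) :
    ‖kernelRow hk x‖ ^ 2 ≤ (∫ y, h y ^ 2) * g x ^ 2 := by
  rw [kernelRow, Lp.norm_toLp, eLpNorm_toReal_sq (memLp_conj (hk.memLp_right x)),
    ← integral_mul_const]
  refine integral_mono_of_nonneg (Eventually.of_forall fun _ => by positivity)
          (hk.2.2.1.integrable_sq.mul_const _) (Eventually.of_forall fun y => ?_)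
  have := pow_le_pow_left₀ (norm_nonneg _) (hk.2.2.2 x y) 2
  simp only [RCLike.norm_conj]
  linarith [mul_pow (g x) (h y) 2]

/-- Integral operators with dominated kernels are Hilbert-Schmidt. -/
theorem summable_norm_kernelOp_sq (hk : IsDominatedBy k g h) {ι : Type}
    (b : HilbertBasis ι ℂ ModeSpace) :
    Summable fun i => ∫ x, ‖∫ y, k x y * b i y‖ ^ 2 := by
  refine summable_of_sum_le (c := ∫ x, (∫ y, h y ^ 2) * g x ^ 2)
    (fun i => integral_nonneg fun _ => by positivity) fun s => ?_
  rw [← integral_finsetSum _ fun i _ => (hk.memLp_integral (b i)).norm.integrable_sq]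
  refine integral_mono_of_nonneg
    (Eventually.of_forall fun _ => Finset.sum_nonneg fun _ _ => by positivity)
    (hk.2.1.integrable_sq.const_mul _) (Eventually.of_forall fun x => ?_)
  refine le_trans ?_ (norm_kernelRow_sq_le hk x)
  have := b.orthonormal.sum_inner_products_le (kernelRow hk x) (s := s)
  refine le_trans (le_of_eq ?_) this
  refine Finset.sum_congr rfl fun i _ => ?_
  rw [← inner_kernelRow, norm_inner_symm]

/-- The trace of a product of two integral operators: Parseval's identity in the second variable,
for each value of the first one. -/
theorem hasTrace_star_kernelOp_mul (hk : IsDominatedBy k g h) (hl : IsDominatedBy l g' h') :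
    HasTrace (star (kernelOp hk) * kernelOp hl) (∫ x, ∫ y, starRingEnd ℂ (k x y) * l x y) := by
  intro ι b
  have : Fact ((2 : ℝ≥0∞) ≠ ∞) := ⟨ENNReal.ofNat_ne_top⟩
  have : Countable ι := countable_of_hilbertBasis b
  set F : ι → ℝ → ℂ := fun i x =>
    starRingEnd ℂ (∫ y, k x y * b i y) * ∫ y, l x y * b i y with hF
  have hterm : ∀ i, inner ℂ (b i) ((star (kernelOp hk) * kernelOp hl) (b i)) = ∫ x, F i x := by
    intro i
    rw [mul_apply_eq_comp, ContinuousLinearMap.star_eq_adjoint,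
      ContinuousLinearMap.adjoint_inner_right, L2.inner_def]
    apply integral_congr_ae
    filter_upwards [kernelOp_ae hk (b i), kernelOp_ae hl (b i)] with x hx hx'
    rw [hx, hx', RCLike.inner_apply, mul_comm]
  have hint : ∀ i, Integrable (F i) volume := fun i =>
    (memLp_conj (hk.memLp_integral (b i))).integrable_mul (hl.memLp_integral (b i))
  have hsum : Summable fun i => ∫ x, ‖F i x‖ := by
    refine Summable.of_nonneg_of_le (fun i => integral_nonneg fun _ => norm_nonneg _)
      (fun i => ?_) ((summable_norm_kernelOp_sq hk b).add (summable_norm_kernelOp_sq hl b))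
    rw [← integral_add (hk.memLp_integral (b i)).norm.integrable_sq
      (hl.memLp_integral (b i)).norm.integrable_sq]
    refine integral_mono (hint i).norm ((hk.memLp_integral (b i)).norm.integrable_sq.add
      (hl.memLp_integral (b i)).norm.integrable_sq) fun x => ?_
    simp only [hF, norm_mul, RCLike.norm_conj]
    nlinarith [sq_nonneg (‖∫ y, k x y * b i y‖ - ‖∫ y, l x y * b i y‖),
      sq_nonneg (‖∫ y, k x y * b i y‖), sq_nonneg (‖∫ y, l x y * b i y‖)]
  have hmain := hasSum_integral_of_summable_integral_norm hint hsum
  simp only [hterm]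
  suffices h : ∫ x, ∫ y, starRingEnd ℂ (k x y) * l x y = ∫ x, ∑' i, F i x by
    rw [h]
    exact hmain
  refine integral_congr_ae (Eventually.of_forall fun x => ?_)
  dsimp only
  rw [← inner_kernelRow_kernelRow hk hl, ← (b.hasSum_inner_mul_inner _ _).tsum_eq]
  refine tsum_congr fun i => ?_
  rw [hF]
  dsimp only
  rw [← inner_kernelRow hk, ← inner_kernelRow hl, inner_conj_symm, mul_comm]

end trace

/-! ### Real powers of the members of a contraction semigroup -/

section semigroup

variable {A : Type} [CStarAlgebra A]

/-- In a self-adjoint semigroup `‖K t‖ ^ 2 = ‖K (2 * t)‖`, so a bound for large `t` carries over to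
all `t`. -/
theorem norm_le_one_of_selfAdjoint_semigroup (K : ℝ → A) (hstar : ∀ t, 0 < t → star (K t) = K t)
    (hmul : ∀ s t, 0 < s → 0 < t → K s * K t = K (s + t)) {t₀ : ℝ}
    (hbig : ∀ t, 0 < t → t₀ ≤ t → ‖K t‖ ≤ 1) {t : ℝ} (ht : 0 < t) : ‖K t‖ ≤ 1 := by
  have hbig' : ∀ n : ℕ, ∀ t : ℝ, 0 < t → t₀ ≤ 2 ^ n * t → ‖K t‖ ≤ 1 := by
    intro n
    induction n with
    | zero => simpa using hbig
    | succ n ih =>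
      intro t ht h2
      have h3 := ih (2 * t) (by linarith) (by rw [pow_succ] at h2; linarith)
      have h4 : ‖K (2 * t)‖ = ‖K t‖ * ‖K t‖ := by
        rw [two_mul, ← hmul t t ht ht]
        nth_rw 1 [← hstar t ht]
        exact CStarRing.norm_star_mul_self
      nlinarith [norm_nonneg (K t)]
  obtain ⟨n, hn⟩ := pow_unbounded_of_one_lt (t₀ / t) (one_lt_two : (1 : ℝ) < 2)
  exact hbig' n t ht (by rw [div_lt_iff₀ ht] at hn; exact hn.le)

variable [PartialOrder A] [StarOrderedRing A]

theorem continuousAt_rpow_exponent (a : A) {s : ℝ} (hs : 0 < s) :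
    ContinuousAt (fun t : ℝ => CFC.rpow a t) s := by
  have hcomp : IsCompact (spectrum NNReal a) := spectrum.isCompact_nnreal a
  have hK : IsCompact (Set.Icc (s / 2) (2 * s) ×ˢ spectrum NNReal a) := isCompact_Icc.prod hcomp
  have hcont : ContinuousOn (Function.uncurry fun (t : ℝ) (x : NNReal) => x ^ t)
      (Set.Icc (s / 2) (2 * s) ×ˢ spectrum NNReal a) := by
    rintro ⟨t, x⟩ ⟨ht, -⟩
    have ht' : 0 < t := by have := ht.1; simp only at this; linarith
    have h1 : ContinuousAt (fun p : NNReal × ℝ => p.1 ^ p.2) (x, t) :=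
      NNReal.continuousAt_rpow (Or.inr ht')
    exact (ContinuousAt.comp (f := Prod.swap) (x := (t, x)) h1
      continuous_swap.continuousAt).continuousWithinAt
  have hun := hK.uniformContinuousOn_of_continuous hcont
  have hmem : Set.Icc (s / 2) (2 * s) ∈ 𝓝 s := Icc_mem_nhds (by linarith) (by linarith)
  have htend := UniformContinuousOn.tendstoUniformlyOn (F := fun (t : ℝ) (x : NNReal) => x ^ t) hun
    (mem_of_mem_nhds hmem)
  rw [nhdsWithin_eq_nhds.2 hmem] at htend
  refine tendsto_cfc_fun htend ?_
  · filter_upwards [lt_mem_nhds hs] with t ht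
    exact (NNReal.continuous_rpow_const ht.le).continuousOn

/-- A positive contraction semigroup consists of the powers of its members: at rational multiples
by uniqueness of roots, and in between because the semigroup is decreasing. -/
theorem rpow_of_contraction_semigroup (K : ℝ → A) (hnonneg : ∀ t, 0 < t → 0 ≤ K t)
    (hone : ∀ t, 0 < t → K t ≤ 1) (hmul : ∀ s t, 0 < s → 0 < t → K s * K t = K (s + t))
    {b s : ℝ} (hb : 0 < b) (hs : 0 < s) : CFC.rpow (K b) s = K (s * b) := by
  have hpow : ∀ t, 0 < t → ∀ n : ℕ, K t ^ (n + 1) = K ((n + 1 : ℕ) * t) := by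
    intro t ht n
    induction n with
    | zero => simp
    | succ n ih =>
      rw [pow_succ, ih, hmul _ _ (by positivity) ht]
      congr 1
      push_cast
      ring
  -- `K (b / d)` is a `d`-th root of `K b`, and positive roots are unique
  have hrat : ∀ r : ℚ, 0 < (r : ℝ) → CFC.rpow (K b) r = K (r * b) := by
    intro r hr
    have hr' : 0 < r := by exact_mod_cast hr
    obtain ⟨n, hn⟩ := Nat.exists_eq_succ_of_ne_zero r.den_nz
    obtain ⟨k, hk⟩ := Nat.exists_eq_succ_of_ne_zero (n := r.num.toNat)
      (by have := Rat.num_pos.2 hr'; omega)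
    have hd : (0 : ℝ) < (n + 1 : ℕ) := by positivity
    have hrk : (r : ℝ) = (k + 1 : ℕ) / (n + 1 : ℕ) := by
      rw [Rat.cast_def, hn]
      have : (r.num : ℝ) = ((r.num.toNat : ℤ) : ℝ) := by
        rw [Int.toNat_of_nonneg (Rat.num_pos.2 hr').le]
      rw [this, hk]
      simp
    set a := K (b / (n + 1 : ℕ)) with ha
    have ha0 : 0 ≤ a := hnonneg _ (by positivity)
    have h1 : K b = a ^ ((n + 1 : ℕ) : ℝ) := by
      rw [CFC.rpow_natCast a _ ha0, ha, hpow _ (by positivity)]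
      congr 1
      field_simp
    rw [h1, CFC.rpow_eq_pow, CFC.rpow_rpow_of_exponent_nonneg a _ _ hd.le hr.le ha0]
    have h2 : ((n + 1 : ℕ) : ℝ) * r = (k + 1 : ℕ) := by rw [hrk]; field_simp
    rw [h2, CFC.rpow_natCast a _ ha0, ha, hpow _ (by positivity), hrk]
    congr 1
    field_simp
  have hanti : ∀ s t, 0 < s → s < t → K t ≤ K s := by
    intro s t hs hst
    have h1 : K t = K (s / 2) * K (t - s) * K (s / 2) := by
      rw [hmul _ _ (by linarith) (by linarith), hmul _ _ (by linarith) (by linarith)]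
      congr 1
      ring
    have h2 : K s = K (s / 2) * 1 * K (s / 2) := by
      rw [mul_one, hmul _ _ (by linarith) (by linarith), add_halves]
    rw [h1, h2]
    exact conjugate_le_conjugate_of_nonneg (hone _ (by linarith)) (hnonneg _ (by linarith))
  -- rational exponents above and below `s` bound `K b ^ s` by `K (s * b)` from both sides
  have hcont := continuousAt_rpow_exponent (K b) hs
  apply le_antisymm
  · obtain ⟨u, -, hu, hlim⟩ := Real.exists_seq_rat_strictAnti_tendsto s
    refine le_of_tendsto (hcont.tendsto.comp hlim) (Eventually.of_forall fun n => ?_)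
    simp only [Function.comp_apply]
    rw [hrat _ (hs.trans (hu n))]
    exact hanti _ _ (by positivity) (by nlinarith [hu n])
  · obtain ⟨u, -, hu, hlim⟩ := Real.exists_seq_rat_strictMono_tendsto s
    refine ge_of_tendsto (hcont.tendsto.comp hlim) ?_
    filter_upwards [hlim.eventually (lt_mem_nhds hs)] with n hn
    simp only [Function.comp_apply] at hn ⊢
    rw [hrat _ hn]
    exact hanti _ _ (by positivity) (by nlinarith [hu n])

theorem rpow_smul (a : A) (ha : 0 ≤ a) {c : ℝ} (hc : 0 ≤ c) {s : ℝ} (hs : 0 ≤ s) :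
    CFC.rpow (c • a) s = c ^ s • CFC.rpow a s := by
  lift c to NNReal using hc
  have h1 : (c : ℝ) • a = c • a := rfl
  have h2 : ((c : ℝ) ^ s) • CFC.rpow a s = (c ^ s) • CFC.rpow a s := by
    rw [← NNReal.coe_rpow]
    rfl
  have hcont : Continuous fun x : NNReal => x ^ s := NNReal.continuous_rpow_const hs
  rw [h1, h2]
  unfold CFC.rpow
  rw [← cfc_comp_const_mul c (fun x : NNReal => x ^ s) a hcont.continuousOn ha,
    ← cfc_const_mul (c ^ s) (fun x : NNReal => x ^ s) a hcont.continuousOn]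
  simp only [NNReal.mul_rpow]

theorem nonneg_of_selfAdjoint_semigroup (K : ℝ → A) (hstar : ∀ t, 0 < t → star (K t) = K t)
    (hmul : ∀ s t, 0 < s → 0 < t → K s * K t = K (s + t)) {t : ℝ} (ht : 0 < t) : 0 ≤ K t := by
  have h : K t = star (K (t / 2)) * K (t / 2) := by
    rw [hstar _ (by linarith), hmul _ _ (by linarith) (by linarith), add_halves]
  rw [h]
  exact star_mul_self_nonneg _

end semigroup

section operator

variable {H : Type} [NormedAddCommGroup H] [InnerProductSpace ℂ H] [CompleteSpace H]

/-- The power `T ^ s` of the continuous functional calculus of bounded operators. -/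
noncomputable def opPow (T : H →L[ℂ] H) (s : ℝ) : H →L[ℂ] H := CFC.rpow T s

theorem chernoffProduct_eq (S T : H →L[ℂ] H) (s : ℝ) :
    chernoffProduct S T s = opPow S s * opPow T (1 - s) := rfl

theorem opPow_zero {T : H →L[ℂ] H} (hT : 0 ≤ T) : opPow T 0 = 1 := CFC.rpow_zero T hT

theorem opPow_one {T : H →L[ℂ] H} (hT : 0 ≤ T) : opPow T 1 = T := CFC.rpow_one T hT

theorem opPow_smul_semigroup (K : ℝ → H →L[ℂ] H) (hstar : ∀ t, 0 < t → star (K t) = K t)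
    (hmul : ∀ s t, 0 < s → 0 < t → K s * K t = K (s + t)) {t₀ : ℝ}
    (hbig : ∀ t, 0 < t → t₀ ≤ t → ‖K t‖ ≤ 1) {b s c : ℝ} (hb : 0 < b) (hs : 0 < s) (hc : 0 ≤ c) :
    opPow (c • K b) s = c ^ s • K (s * b) := by
  have hnonneg : ∀ t, 0 < t → 0 ≤ K t := fun t => nonneg_of_selfAdjoint_semigroup K hstar hmul
  have hone : ∀ t, 0 < t → K t ≤ 1 := fun t ht =>
    (CStarAlgebra.norm_le_one_iff_of_nonneg _ (hnonneg t ht)).1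
      (norm_le_one_of_selfAdjoint_semigroup K hstar hmul hbig ht)
  unfold opPow
  rw [rpow_smul _ (hnonneg b hb) hc hs.le, rpow_of_contraction_semigroup K hnonneg hone hmul hb hs]

theorem opSmul_nonneg {T : H →L[ℂ] H} (hT : 0 ≤ T) {c : ℝ} (hc : 0 ≤ c) : 0 ≤ c • T :=
  smul_nonneg hc hT

end operator

/-! ### The Mehler semigroup of a squeezed and displaced oscillator -/

/-- A squeezing and a displacement of one mode. The symmetric matrix
`M = [[width, shear * width], [shear * width, shear ^ 2 * width + 1 / width]]` is the general
positive definite matrix of determinant one, and `(pos, mom)` is the displacement vector. -/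
structure ModeFrame where
  /-- The position variance of the squeezed vacuum, up to normalization. -/
  width : ℝ
  /-- The coefficient of the quadratic phase ("chirp") of the squeezed vacuum. -/
  shear : ℝ
  /-- Mean position. -/
  pos : ℝ
  /-- Mean momentum. -/
  mom : ℝ
  width_pos : 0 < width

/-- The Mehler kernel of `exp (-t (n̂ + 1/2))`, for an oscillator whose position variable is
rescaled by `√m`. -/
noncomputable def mehler (m t X Y : ℝ) : ℝ :=
  (√(2 * Real.pi * m * Real.sinh t))⁻¹ *
    Real.exp (-(Real.cosh t * (X ^ 2 + Y ^ 2) - 2 * X * Y) / (2 * m * Real.sinh t))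

namespace ModeFrame

/-- The phase of the squeezed and displaced vacuum. -/
noncomputable def phase (F : ModeFrame) (x : ℝ) : ℝ :=
  F.shear * (x - F.pos) ^ 2 / 2 + F.mom * x

/-- The kernel of `exp (-t (n̂ + 1/2))` conjugated by the squeezing and displacement `F`. -/
noncomputable def kernel (F : ModeFrame) (t x y : ℝ) : ℂ :=
  (mehler F.width t (x - F.pos) (y - F.pos) : ℂ) *
    Complex.exp (((F.phase x - F.phase y : ℝ) : ℂ) * Complex.I)

end ModeFrame

theorem integral_exp_quadratic {a : ℝ} (ha : 0 < a) (b c : ℝ) :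
    ∫ x : ℝ, Real.exp (-a * x ^ 2 + b * x + c) =
      √(Real.pi / a) * Real.exp (b ^ 2 / (4 * a) + c) := by
  have h1 : ∀ x : ℝ, Real.exp (-a * x ^ 2 + b * x + c)
      = Real.exp (-a * (x - b / (2 * a)) ^ 2) * Real.exp (b ^ 2 / (4 * a) + c) := by
    intro x
    rw [← Real.exp_add]
    congr 1
    field_simp
    ring
  simp only [h1]
  rw [integral_mul_const,
    integral_sub_right_eq_self (fun x => Real.exp (-a * x ^ 2)) (b / (2 * a)), integral_gaussian]

/-- The semigroup law of the Mehler kernels. -/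
theorem integral_mehler_mul_mehler {m s t : ℝ} (hm : 0 < m) (hs : 0 < s) (ht : 0 < t) (X Y : ℝ) :
    ∫ Z, mehler m s X Z * mehler m t Z Y = mehler m (s + t) X Y := by
  have hS := Real.sinh_pos_iff.2 hs
  have hT := Real.sinh_pos_iff.2 ht
  have hST : 0 < Real.sinh (s + t) := Real.sinh_pos_iff.2 (by linarith)
  have hadd := Real.sinh_add s t
  have hadd' := Real.cosh_add s t
  have hcs := Real.cosh_sq s
  have hct := Real.cosh_sq t
  generalize hU : Real.sinh (s + t) = U at *
  generalize hV : Real.cosh (s + t) = V at *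
  simp only [mehler, hU, hV]
  generalize Real.sinh s = S at *
  generalize Real.sinh t = T at *
  generalize Real.cosh s = C at *
  generalize Real.cosh t = D at *
  have ha : 0 < U / (2 * m * S * T) := by positivity
  have h1 : ∀ Z, (√(2 * Real.pi * m * S))⁻¹ *
      Real.exp (-(C * (X ^ 2 + Z ^ 2) - 2 * X * Z) / (2 * m * S)) *
      ((√(2 * Real.pi * m * T))⁻¹ *
      Real.exp (-(D * (Z ^ 2 + Y ^ 2) - 2 * Z * Y) / (2 * m * T))) =
      ((√(2 * Real.pi * m * S))⁻¹ * (√(2 * Real.pi * m * T))⁻¹) *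
      Real.exp (-(U / (2 * m * S * T)) * Z ^ 2 + ((X * T + Y * S) / (m * S * T)) * Z +
        (-(C * X ^ 2) / (2 * m * S) - D * Y ^ 2 / (2 * m * T))) := by
    intro Z
    rw [mul_mul_mul_comm, ← Real.exp_add]
    congr 2
    rw [hadd]
    field_simp
    ring
  simp only [h1]
  rw [integral_const_mul, integral_exp_quadratic ha, ← mul_assoc]
  congr 1
  · rw [← Real.sqrt_inv, ← Real.sqrt_inv, ← Real.sqrt_inv, ← Real.sqrt_mul (by positivity),
      ← Real.sqrt_mul (by positivity)]
    congr 1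
    field_simp
  · congr 1
    rw [hadd']
    field_simp
    rw [hadd]
    linear_combination (-4 * (T ^ 2 * X ^ 2)) * hcs + (-4 * (S ^ 2 * Y ^ 2)) * hct

theorem mehler_symm (m t X Y : ℝ) : mehler m t X Y = mehler m t Y X := by
  unfold mehler
  ring_nf

theorem mehler_nonneg (m t X Y : ℝ) : 0 ≤ mehler m t X Y := by
  unfold mehler
  positivity

theorem tanh_half_pos {t : ℝ} (ht : 0 < t) : 0 < Real.tanh (t / 2) := by
  rw [Real.tanh_eq_sinh_div_cosh]
  exact div_pos (Real.sinh_pos_iff.2 (by linarith)) (Real.cosh_pos _)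

theorem sinh_eq_two_mul (t : ℝ) :
    Real.sinh t = 2 * Real.sinh (t / 2) * Real.cosh (t / 2) := by
  rw [← Real.sinh_two_mul]
  congr 1
  ring

theorem cosh_eq_two_mul (t : ℝ) : Real.cosh t = 2 * Real.sinh (t / 2) ^ 2 + 1 := by
  have h := Real.cosh_two_mul (t / 2)
  rw [mul_div_cancel₀ _ two_ne_zero, Real.cosh_sq] at h
  linarith

/-- In mean and difference coordinates the Mehler kernel is a product of two Gaussians. -/
theorem mehler_eq_tanh {m t : ℝ} (hm : 0 < m) (ht : 0 < t) (X Y : ℝ) :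
    mehler m t X Y = (√(2 * Real.pi * m * Real.sinh t))⁻¹ *
      Real.exp (-(Real.tanh (t / 2) / m * ((X + Y) / 2) ^ 2)
        - (X - Y) ^ 2 / (4 * Real.tanh (t / 2) * m)) := by
  have h1 : 0 < Real.sinh (t / 2) := Real.sinh_pos_iff.2 (by linarith)
  have h2 := Real.cosh_pos (t / 2)
  have h3 := Real.cosh_sq (t / 2)
  rw [mehler]
  congr 2
  rw [Real.tanh_eq_sinh_div_cosh, sinh_eq_two_mul t, cosh_eq_two_mul t]
  field_simp
  rw [h3]
  ring

/-- The bound of the Mehler kernel by a product of two Gaussians. -/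
theorem mehler_le {m t : ℝ} (hm : 0 < m) (ht : 0 < t) (X Y : ℝ) :
    mehler m t X Y ≤ ((√(2 * Real.pi * m * Real.sinh t))⁻¹ *
      Real.exp (-(Real.tanh (t / 2) / (2 * m)) * X ^ 2)) *
      Real.exp (-(Real.tanh (t / 2) / (2 * m)) * Y ^ 2) := by
  have h1 : 0 < Real.sinh (t / 2) := Real.sinh_pos_iff.2 (by linarith)
  have h2 := Real.cosh_pos (t / 2)
  rw [mehler, mul_assoc _ (Real.exp _), ← Real.exp_add]
  refine mul_le_mul_of_nonneg_left (Real.exp_le_exp.2 ?_) (by positivity)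
  have h3 : -(Real.tanh (t / 2) / (2 * m)) * X ^ 2 + -(Real.tanh (t / 2) / (2 * m)) * Y ^ 2
      - -(Real.cosh t * (X ^ 2 + Y ^ 2) - 2 * X * Y) / (2 * m * Real.sinh t)
      = (X - Y) ^ 2 / (2 * m * Real.sinh t) := by
    rw [Real.tanh_eq_sinh_div_cosh, sinh_eq_two_mul t, cosh_eq_two_mul t]
    field_simp
    ring
  have h4 : 0 < Real.sinh t := Real.sinh_pos_iff.2 ht
  have : 0 ≤ (X - Y) ^ 2 / (2 * m * Real.sinh t) := by positivity
  linarith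

theorem memLp_gaussian {c : ℝ} (hc : 0 < c) (N q : ℝ) :
    MemLp (fun x : ℝ => N * Real.exp (-c * (x - q) ^ 2)) 2 volume := by
  have hcont : Continuous fun x : ℝ => N * Real.exp (-c * (x - q) ^ 2) := by fun_prop
  refine (memLp_two_iff_integrable_sq hcont.aestronglyMeasurable).2 ?_
  have h := ((integrable_exp_neg_mul_sq (b := 2 * c) (by linarith)).comp_sub_right q).const_mul
    (N ^ 2)
  refine h.congr (Eventually.of_forall fun x => ?_)
  simp only
  rw [mul_pow, ← Real.exp_nat_mul]
  congr 2
  push_cast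
  ring

theorem integral_gaussian_sq (c N q : ℝ) :
    ∫ x : ℝ, (N * Real.exp (-c * (x - q) ^ 2)) ^ 2 = N ^ 2 * √(Real.pi / (2 * c)) := by
  have h : ∀ x : ℝ, (N * Real.exp (-c * (x - q) ^ 2)) ^ 2
      = N ^ 2 * Real.exp (-(2 * c) * (x - q) ^ 2) := by
    intro x
    rw [mul_pow, ← Real.exp_nat_mul]
    congr 2
    push_cast
    ring
  simp only [h]
  rw [integral_const_mul, integral_sub_right_eq_self (fun x => Real.exp (-(2 * c) * x ^ 2)) q,
    integral_gaussian]

namespace ModeFrame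

theorem norm_kernel (F : ModeFrame) (t x y : ℝ) :
    ‖F.kernel t x y‖ = mehler F.width t (x - F.pos) (y - F.pos) := by
  rw [kernel, norm_mul, Complex.norm_exp_ofReal_mul_I, mul_one, Complex.norm_real,
    Real.norm_of_nonneg (mehler_nonneg _ _ _ _)]

theorem continuous_kernel (F : ModeFrame) (t : ℝ) :
    Continuous (Function.uncurry (F.kernel t)) := by
  unfold Function.uncurry kernel mehler phase
  fun_prop

/-- The Gaussian dominating the kernel in its first variable. -/
noncomputable def boundLeft (F : ModeFrame) (t x : ℝ) : ℝ :=
  (√(2 * Real.pi * F.width * Real.sinh t))⁻¹ *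
      Real.exp (-(Real.tanh (t / 2) / (2 * F.width)) * (x - F.pos) ^ 2)

/-- The Gaussian dominating the kernel in its second variable. -/
noncomputable def boundRight (F : ModeFrame) (t y : ℝ) : ℝ :=
  1 * Real.exp (-(Real.tanh (t / 2) / (2 * F.width)) * (y - F.pos) ^ 2)

theorem isDominatedBy_kernel (F : ModeFrame) {t : ℝ} (ht : 0 < t) :
    IsDominatedBy (F.kernel t) (F.boundLeft t) (F.boundRight t) := by
  have hc : 0 < Real.tanh (t / 2) / (2 * F.width) :=
    div_pos (tanh_half_pos ht) (by linarith [F.width_pos])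
  refine ⟨F.continuous_kernel t, memLp_gaussian hc _ _, memLp_gaussian hc _ _, fun x y => ?_⟩
  rw [norm_kernel, boundLeft, boundRight, one_mul]
  exact mehler_le F.width_pos ht _ _

theorem conj_kernel (F : ModeFrame) (t x y : ℝ) :
    starRingEnd ℂ (F.kernel t x y) = F.kernel t y x := by
  rw [kernel, kernel, map_mul, Complex.conj_ofReal, ← Complex.exp_conj, map_mul,
    Complex.conj_ofReal, Complex.conj_I, mehler_symm]
  congr 2
  push_cast
  ring

theorem integral_kernel_mul_kernel (F : ModeFrame) {s t : ℝ} (hs : 0 < s) (ht : 0 < t) (x y : ℝ) :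
    ∫ z, F.kernel s x z * F.kernel t z y = F.kernel (s + t) x y := by
  have h1 : ∀ z, F.kernel s x z * F.kernel t z y =
      ((mehler F.width s (x - F.pos) (z - F.pos) *
          mehler F.width t (z - F.pos) (y - F.pos) : ℝ) : ℂ)
        * Complex.exp (((F.phase x - F.phase y : ℝ) : ℂ) * Complex.I) := by
    intro z
    rw [kernel, kernel, mul_mul_mul_comm, ← Complex.exp_add]
    push_cast
    congr 2
    ring
  simp only [h1]
  rw [integral_mul_const, integral_complex_ofReal,
    integral_sub_right_eq_self (fun z => mehler F.width s (x - F.pos) z *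
      mehler F.width t z (y - F.pos)) F.pos, integral_mehler_mul_mehler F.width_pos hs ht, kernel]

/-- The operator `exp (-t (n̂ + 1/2))`, conjugated by the squeezing and displacement `F`
(and `0` for `t ≤ 0`). -/
noncomputable def op (F : ModeFrame) (t : ℝ) : ModeSpace →L[ℂ] ModeSpace :=
  if ht : 0 < t then kernelOp (F.isDominatedBy_kernel ht) else 0

theorem op_of_pos (F : ModeFrame) {t : ℝ} (ht : 0 < t) :
    F.op t = kernelOp (F.isDominatedBy_kernel ht) := dif_pos ht

theorem op_mul_op (F : ModeFrame) {s t : ℝ} (hs : 0 < s) (ht : 0 < t) :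
    F.op s * F.op t = F.op (s + t) := by
  rw [F.op_of_pos hs, F.op_of_pos ht, F.op_of_pos (add_pos hs ht)]
  exact kernelOp_mul _ _ _ (F.integral_kernel_mul_kernel hs ht)

theorem star_op (F : ModeFrame) {t : ℝ} (ht : 0 < t) : star (F.op t) = F.op t := by
  rw [F.op_of_pos ht, star_kernelOp]
  exact kernelOp_congr _ _ fun x y => F.conj_kernel t y x

theorem op_nonneg (F : ModeFrame) {t : ℝ} (ht : 0 < t) : 0 ≤ F.op t :=
  nonneg_of_selfAdjoint_semigroup F.op (fun _ => F.star_op) (fun _ _ => F.op_mul_op) ht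

/-- The Hilbert-Schmidt type bound by the norms of the dominating Gaussians. -/
theorem norm_op_le (F : ModeFrame) {t : ℝ} (ht : 0 < t) :
    ‖F.op t‖ ≤ (2 * Real.sinh (t / 2))⁻¹ := by
  have h1 : 0 < Real.sinh (t / 2) := Real.sinh_pos_iff.2 (by linarith)
  have h2 := Real.cosh_pos (t / 2)
  have hm := F.width_pos
  rw [F.op_of_pos ht]
  refine (norm_kernelOp_le _).trans (le_of_eq ?_)
  unfold boundLeft boundRight
  rw [integral_gaussian_sq, integral_gaussian_sq, Real.sqrt_eq_iff_eq_sq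
    (by positivity) (by positivity)]
  have hp : 0 ≤ Real.pi / (2 * (Real.tanh (t / 2) / (2 * F.width))) := by
    have := tanh_half_pos ht
    positivity
  have h3 := Real.mul_self_sqrt hp
  have h4 : 0 ≤ 2 * Real.pi * F.width * Real.sinh t := by
    have := Real.sinh_pos_iff.2 ht
    positivity
  rw [inv_pow, Real.sq_sqrt h4, one_pow, one_mul, mul_assoc, h3, Real.tanh_eq_sinh_div_cosh,
    sinh_eq_two_mul t]
  field_simp

theorem norm_op_le_one (F : ModeFrame) {t : ℝ} (ht : 0 < t) (h2 : 2 ≤ t) : ‖F.op t‖ ≤ 1 := by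
  refine (F.norm_op_le ht).trans (inv_le_one_of_one_le₀ ?_)
  have := Real.self_le_sinh_iff.2 (show 0 ≤ t / 2 by linarith)
  linarith

/-- The Gaussian state of inverse temperature `β`: `exp (-β (n̂ + 1/2))`, normalized by its trace
`1 / (2 sinh (β / 2))` and conjugated by the squeezing and displacement `F`. -/
noncomputable def state (F : ModeFrame) (β : ℝ) : ModeSpace →L[ℂ] ModeSpace :=
  (2 * Real.sinh (β / 2)) • F.op β

theorem state_nonneg (F : ModeFrame) {β : ℝ} (hβ : 0 < β) : 0 ≤ F.state β := by
  have h1 : 0 < Real.sinh (β / 2) := Real.sinh_pos_iff.2 (by linarith)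
  exact opSmul_nonneg (F.op_nonneg hβ) (by positivity)

theorem opPow_state (F : ModeFrame) {β s : ℝ} (hβ : 0 < β) (hs : 0 < s) :
    opPow (F.state β) s = (2 * Real.sinh (β / 2)) ^ s • F.op (s * β) := by
  have h1 : 0 < Real.sinh (β / 2) := Real.sinh_pos_iff.2 (by linarith)
  exact opPow_smul_semigroup F.op (fun _ => F.star_op) (fun _ _ => F.op_mul_op)
    (fun _ => F.norm_op_le_one) hβ hs (by positivity)

end ModeFrame

/-! ### Traces of products of Gaussian operators -/

theorem IsDominatedBy.integrable_mul_swap {k l : ℝ → ℝ → ℂ} {g h g' h' : ℝ → ℝ}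
    (hk : IsDominatedBy k g h) (hl : IsDominatedBy l g' h') :
    Integrable (fun z : ℝ × ℝ => k z.1 z.2 * l z.2 z.1) (volume.prod volume) := by
  have h1 : Integrable (fun z : ℝ × ℝ => (|g z.1| * |h' z.1|) * (|h z.2| * |g' z.2|))
      (volume.prod volume) :=
    Integrable.mul_prod (hk.2.1.abs.integrable_mul hl.2.2.1.abs)
      (hk.2.2.1.abs.integrable_mul hl.2.1.abs)
  refine h1.mono' ?_ (Eventually.of_forall fun z => ?_)
  · exact (hk.1.mul (hl.1.comp continuous_swap)).aestronglyMeasurable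
  · rw [norm_mul]
    have h2 := (hk.2.2.2 z.1 z.2).trans ((le_abs_self _).trans (abs_mul _ _).le)
    have h3 := (hl.2.2.2 z.2 z.1).trans ((le_abs_self _).trans (abs_mul _ _).le)
    calc _ ≤ (|g z.1| * |h z.2|) * (|g' z.2| * |h' z.1|) := by gcongr
      _ = _ := by ring

theorem hasTrace_kernelOp_mul {k l : ℝ → ℝ → ℂ} {g h g' h' : ℝ → ℝ}
    (hk : IsDominatedBy k g h) (hl : IsDominatedBy l g' h') :
    HasTrace (kernelOp hk * kernelOp hl) (∫ x, ∫ y, k x y * l y x) := by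
  have h1 := hasTrace_star_kernelOp_mul hk.swap hl
  have h2 : star (kernelOp hk.swap) = kernelOp hk := by rw [← star_kernelOp, star_star]
  rw [h2] at h1
  convert h1 using 1
  rw [integral_integral_swap (f := fun x y => k x y * l y x) (hk.integrable_mul_swap hl)]
  simp only [Complex.conj_conj]

/-- Mean and difference coordinates in a double integral. -/
theorem integral_integral_mean_diff {f : ℝ → ℝ → ℂ}
    (hf : Integrable (Function.uncurry f) (volume.prod volume)) :
    ∫ x, ∫ y, f x y = ∫ v, ∫ w, f (w + v / 2) (w - v / 2) := by
  have hmp : MeasurePreserving (fun z : ℝ × ℝ => (z.1 + z.2, z.2)) (volume.prod volume)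
      (volume.prod volume) := measurePreserving_add_prod volume volume
  have hint : Integrable (Function.uncurry fun y v => f (v + y) y) (volume.prod volume) :=
    (hmp.integrable_comp_of_integrable hf).swap
  rw [integral_integral_swap hf]
  have h1 : ∀ y, ∫ x, f x y = ∫ v, f (v + y) y := fun y =>
    (integral_add_right_eq_self (fun x => f x y) y).symm
  simp only [h1]
  rw [integral_integral_swap hint]
  refine integral_congr_ae (Eventually.of_forall fun v => ?_)
  dsimp only
  rw [← integral_sub_right_eq_self (fun y => f (v + y) y) (v / 2)]
  refine integral_congr_ae (Eventually.of_forall fun w => ?_)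
  dsimp only
  congr 1
  ring

theorem integral_cexp_quadratic_real {a : ℝ} (ha : 0 < a) (c d : ℂ) :
    ∫ x : ℝ, Complex.exp (-(a : ℂ) * (x : ℂ) ^ 2 + c * x + d)
      = (√(Real.pi / a) : ℂ) * Complex.exp (d + c ^ 2 / (4 * a)) := by
  rw [integral_cexp_quadratic (by simpa using ha), neg_neg]
  congr 1
  · rw [Real.sqrt_eq_rpow, Complex.ofReal_cpow (by positivity)]
    push_cast
    rfl
  · congr 1
    have : (a : ℂ) ≠ 0 := by exact_mod_cast ha.ne'
    field_simp
    ring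

namespace ModeFrame

/-- The quadratic form of the inverse of the squeezing matrix `M` of a frame. -/
noncomputable def quad (F : ModeFrame) (x y : ℝ) : ℝ :=
  F.width * (y - F.shear * x) ^ 2 + x ^ 2 / F.width

/-- `tr (M₀ M₁⁻¹) - 2` for the squeezing matrices of two frames; it vanishes if and only if they
agree. -/
noncomputable def mismatch (F G : ModeFrame) : ℝ :=
  (F.width - G.width) ^ 2 / (F.width * G.width) + F.width * G.width * (F.shear - G.shear) ^ 2

/-- `sinh² (a/2) sinh² (b/2) det (coth (a/2) M₀ + coth (b/2) M₁)`. -/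
noncomputable def overlapDet (F G : ModeFrame) (a b : ℝ) : ℝ :=
  Real.sinh ((a + b) / 2) ^ 2 + F.mismatch G * Real.sinh a * Real.sinh b / 4

/-- The quadratic form of `(coth (a/2) M₀ + coth (b/2) M₁)⁻¹` at the difference of the two
displacement vectors. -/
noncomputable def overlapExponent (F G : ModeFrame) (a b : ℝ) : ℝ :=
  (Real.sinh a * Real.sinh (b / 2) ^ 2 * F.quad (F.pos - G.pos) (F.mom - G.mom)
    + Real.sinh b * Real.sinh (a / 2) ^ 2 * G.quad (F.pos - G.pos) (F.mom - G.mom))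
    / (2 * F.overlapDet G a b)

theorem quad_nonneg (F : ModeFrame) (x y : ℝ) : 0 ≤ F.quad x y := by
  have := F.width_pos
  unfold quad
  positivity

theorem mismatch_nonneg (F G : ModeFrame) : 0 ≤ F.mismatch G := by
  have := F.width_pos
  have := G.width_pos
  unfold mismatch
  positivity

theorem sinh_half_sq_le_overlapDet (F G : ModeFrame) {a b : ℝ} (ha : 0 ≤ a) (hb : 0 ≤ b) :
    Real.sinh ((a + b) / 2) ^ 2 ≤ F.overlapDet G a b := by
  have h1 := Real.sinh_nonneg_iff.2 ha
  have h2 := Real.sinh_nonneg_iff.2 hb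
  have h3 := F.mismatch_nonneg G
  have : 0 ≤ F.mismatch G * Real.sinh a * Real.sinh b / 4 := by positivity
  unfold overlapDet
  linarith

/-- The product of two Gaussian kernels in mean and difference coordinates. -/
theorem kernel_mul_kernel_mean_diff (F G : ModeFrame) {a b : ℝ} (ha : 0 < a) (hb : 0 < b)
    (v w : ℝ) :
    F.kernel a (w + v / 2) (w - v / 2) * G.kernel b (w - v / 2) (w + v / 2) =
      (((√(2 * Real.pi * F.width * Real.sinh a))⁻¹ *
        (√(2 * Real.pi * G.width * Real.sinh b))⁻¹ : ℝ) : ℂ) *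
      Complex.exp (-((Real.tanh (a / 2) / F.width + Real.tanh (b / 2) / G.width : ℝ) : ℂ) * w ^ 2 +
        (((2 * (Real.tanh (a / 2) / F.width * F.pos + Real.tanh (b / 2) / G.width * G.pos) : ℝ) : ℂ)
          + ((v * (F.shear - G.shear) : ℝ) : ℂ) * Complex.I) * w +
        (((-(Real.tanh (a / 2) / F.width * F.pos ^ 2 + Real.tanh (b / 2) / G.width * G.pos ^ 2)
          - v ^ 2 / 4 * (1 / (Real.tanh (a / 2) * F.width) + 1 / (Real.tanh (b / 2) * G.width))
            : ℝ) : ℂ)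
          + ((v * (F.mom - G.mom - F.shear * F.pos + G.shear * G.pos) : ℝ) : ℂ) * Complex.I)) := by
  rw [kernel, kernel, mehler_eq_tanh F.width_pos ha, mehler_eq_tanh G.width_pos hb,
    mul_mul_mul_comm, ← Complex.exp_add]
  have hT := tanh_half_pos ha
  have hS := tanh_half_pos hb
  have hm := F.width_pos
  have hn := G.width_pos
  generalize Real.tanh (a / 2) = T at *
  generalize Real.tanh (b / 2) = S at *
  push_cast
  rw [mul_mul_mul_comm, mul_assoc _ (_ * _) (Complex.exp _), ← Complex.exp_add, ← Complex.exp_add]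
  congr 2
  unfold phase
  push_cast
  have hT' : (T : ℂ) ≠ 0 := by exact_mod_cast hT.ne'
  have hS' : (S : ℂ) ≠ 0 := by exact_mod_cast hS.ne'
  have hm' : (F.width : ℂ) ≠ 0 := by exact_mod_cast hm.ne'
  have hn' : (G.width : ℂ) ≠ 0 := by exact_mod_cast hn.ne'
  field_simp
  ring

/-- In mean and difference coordinates both integrations are one-dimensional Gaussian integrals, of
width parameters `A` and `B + κ ^ 2 / (4 * A)`. -/
theorem integral_kernel_mul_kernel_swap (F G : ModeFrame) {a b : ℝ} (ha : 0 < a) (hb : 0 < b) :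
    ∫ x, ∫ y, F.kernel a x y * G.kernel b y x =
      (((2 * √(F.overlapDet G a b))⁻¹ * Real.exp (-F.overlapExponent G a b) : ℝ) : ℂ) := by
  rw [integral_integral_mean_diff (f := fun x y => F.kernel a x y * G.kernel b y x)
    ((F.isDominatedBy_kernel ha).integrable_mul_swap (G.isDominatedBy_kernel hb))]
  simp only [F.kernel_mul_kernel_mean_diff G ha hb]
  have hT := tanh_half_pos ha
  have hS := tanh_half_pos hb
  have hm := F.width_pos
  have hn := G.width_pos
  set N := (√(2 * Real.pi * F.width * Real.sinh a))⁻¹ *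
        (√(2 * Real.pi * G.width * Real.sinh b))⁻¹ with hN
  set T := Real.tanh (a / 2) with hTdef
  set S := Real.tanh (b / 2) with hSdef
  set A := T / F.width + S / G.width with hA
  set B := (1 / (T * F.width) + 1 / (S * G.width)) / 4 with hB
  set κ := F.shear - G.shear with hκ
  set R := T / F.width * F.pos + S / G.width * G.pos with hR
  set D := F.mom - G.mom - F.shear * F.pos + G.shear * G.pos with hD
  set E := T / F.width * F.pos ^ 2 + S / G.width * G.pos ^ 2 with hE
  have hA0 : 0 < A := by positivity
  have hB0 : 0 < B := by positivity
  have hB1 : 0 < B + κ ^ 2 / (4 * A) := by positivity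
  have hAC : (A : ℂ) ≠ 0 := by exact_mod_cast hA0.ne'
  have hin : ∀ v : ℝ, ∫ w : ℝ, (N : ℂ) * Complex.exp (-(A : ℂ) * w ^ 2 +
        (((2 * R : ℝ) : ℂ) + ((v * κ : ℝ) : ℂ) * Complex.I) * w +
        (((-E - v ^ 2 / 4 * (1 / (T * F.width) + 1 / (S * G.width)) : ℝ) : ℂ)
          + ((v * D : ℝ) : ℂ) * Complex.I)) =
      ((N * √(Real.pi / A) : ℝ) : ℂ) * Complex.exp (-((B + κ ^ 2 / (4 * A) : ℝ) : ℂ) * v ^ 2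
        + (((D + R * κ / A : ℝ) : ℂ) * Complex.I) * v + ((-E + R ^ 2 / A : ℝ) : ℂ)) := by
    intro v
    rw [integral_const_mul, integral_cexp_quadratic_real hA0, ← mul_assoc]
    push_cast
    congr 2
    rw [hB]
    have hI := Complex.I_sq
    have h4 : (v : ℂ) ^ 2 / 4 * (1 / (T * F.width) + 1 / (S * G.width))
        = v ^ 2 * ((1 / (T * F.width) + 1 / (S * G.width)) / 4) := by ring
    push_cast
    rw [h4]
    generalize ((1 : ℂ) / (T * F.width) + 1 / (S * G.width)) / 4 = B'
    field_simp
    ring_nf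
    rw [hI]
    ring
  simp only [hin]
  rw [integral_const_mul, integral_cexp_quadratic_real hB1]
  -- the linear term is purely imaginary, so the value of the integral is real
  have hreal : ((-E + R ^ 2 / A : ℝ) : ℂ) + (((D + R * κ / A : ℝ) : ℂ) * Complex.I) ^ 2 /
      (4 * ((B + κ ^ 2 / (4 * A) : ℝ) : ℂ)) =
      ((-E + R ^ 2 / A - (D + R * κ / A) ^ 2 / (4 * (B + κ ^ 2 / (4 * A))) : ℝ) : ℂ) := by
    rw [mul_pow, Complex.I_sq]
    push_cast
    ring
  rw [hreal, ← Complex.ofReal_exp, ← mul_assoc, ← Complex.ofReal_mul, ← Complex.ofReal_mul]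
  congr 1
  have hs0 : 0 < Real.sinh (a / 2) := Real.sinh_pos_iff.2 (by linarith)
  have hs1 : 0 < Real.sinh (b / 2) := Real.sinh_pos_iff.2 (by linarith)
  have hc0 := Real.cosh_pos (a / 2)
  have hc1 := Real.cosh_pos (b / 2)
  have hVpos : 0 < F.overlapDet G a b := by
    refine lt_of_lt_of_le ?_ (F.sinh_half_sq_le_overlapDet G ha.le hb.le)
    have : 0 < Real.sinh ((a + b) / 2) := Real.sinh_pos_iff.2 (by linarith)
    positivity
  -- the determinant of the two-dimensional Gaussian integral
  have hAB : A * (B + κ ^ 2 / (4 * A)) * (F.width * G.width * Real.sinh a * Real.sinh b)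
      = F.overlapDet G a b := by
    have h1 : A * (B + κ ^ 2 / (4 * A)) = A * B + κ ^ 2 / 4 := by
      field_simp
    rw [h1, overlapDet, mismatch, hA, hB, hTdef, hSdef, Real.tanh_eq_sinh_div_cosh,
      Real.tanh_eq_sinh_div_cosh, add_div a b, Real.sinh_add, sinh_eq_two_mul a,
      sinh_eq_two_mul b, ← hκ]
    field_simp
    ring
  congr 1
  · have hNsq : N = √((2 * Real.pi * F.width * Real.sinh a)⁻¹ *
        (2 * Real.pi * G.width * Real.sinh b)⁻¹) := by
      have := Real.sinh_pos_iff.2 ha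
      rw [hN, ← Real.sqrt_inv, ← Real.sqrt_inv, Real.sqrt_mul (by positivity)]
    have h4 : (2 : ℝ) = √4 := by
      rw [show (4 : ℝ) = 2 ^ 2 by norm_num, Real.sqrt_sq (by norm_num)]
    have := Real.sinh_pos_iff.2 ha
    have := Real.sinh_pos_iff.2 hb
    rw [hNsq, ← Real.sqrt_mul (by positivity), ← Real.sqrt_mul (by positivity), h4,
      ← Real.sqrt_mul (by positivity), ← Real.sqrt_inv]
    congr 1
    rw [← hAB, ← h4]
    field_simp
    norm_num
  · congr 1
    have h1 : -E + R ^ 2 / A = -(T * S / (F.width * G.width * A) * (F.pos - G.pos) ^ 2) := by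
      rw [hE, hR]
      field_simp
      rw [hA]
      field_simp
      ring
    have h2 : D + R * κ / A = (F.mom - G.mom) -
        (F.shear * (S / G.width) + G.shear * (T / F.width)) / A * (F.pos - G.pos) := by
      rw [hD, hR, hκ]
      field_simp
      rw [hA]
      field_simp
      ring
    have h3 : (T * S / (F.width * G.width * A) * (F.pos - G.pos) ^ 2) +
        ((F.mom - G.mom) - (F.shear * (S / G.width) + G.shear * (T / F.width)) / A *
          (F.pos - G.pos)) ^ 2 / (4 * (B + κ ^ 2 / (4 * A))) =
        (S / G.width * F.quad (F.pos - G.pos) (F.mom - G.mom) / F.width +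
          T / F.width * G.quad (F.pos - G.pos) (F.mom - G.mom) / G.width) /
          (4 * (A * (B + κ ^ 2 / (4 * A)))) := by
      rw [eq_div_iff (by positivity)]
      have h4 : ∀ X Y : ℝ, (X + Y ^ 2 / (4 * (B + κ ^ 2 / (4 * A)))) *
          (4 * (A * (B + κ ^ 2 / (4 * A)))) = X * (4 * (A * B) + κ ^ 2) + A * Y ^ 2 := by
        intro X Y
        field_simp
      rw [h4]
      generalize F.pos - G.pos = x
      generalize F.mom - G.mom = y
      rw [hB, hκ]
      unfold quad
      field_simp
      rw [hA]
      field_simp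
      ring
    rw [h1, h2, overlapExponent, ← neg_add', h3, ← hAB, hTdef, hSdef, Real.tanh_eq_sinh_div_cosh,
      Real.tanh_eq_sinh_div_cosh, sinh_eq_two_mul a, sinh_eq_two_mul b]
    field_simp
    ring

/-- The trace of a product of two Gaussian operators. -/
theorem hasTrace_op_mul_op (F G : ModeFrame) {a b : ℝ} (ha : 0 < a) (hb : 0 < b) :
    HasTrace (F.op a * G.op b)
      (((2 * √(F.overlapDet G a b))⁻¹ * Real.exp (-F.overlapExponent G a b) : ℝ) : ℂ) := by
  rw [F.op_of_pos ha, G.op_of_pos hb, ← F.integral_kernel_mul_kernel_swap G ha hb]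
  exact hasTrace_kernelOp_mul _ _

end ModeFrame

/-! ### The characteristic function of a Gaussian state -/

/-- The kernel of the composition of a displacement operator and an integral operator. -/
noncomputable def displacedKernel (u : Fin 2 → ℝ) (k : ℝ → ℝ → ℂ) (x y : ℝ) : ℂ :=
  weylPhase u x * k (x - u 0) y

theorem IsDominatedBy.displaced {k : ℝ → ℝ → ℂ} {g h : ℝ → ℝ} (hk : IsDominatedBy k g h)
    (u : Fin 2 → ℝ) : IsDominatedBy (displacedKernel u k) (fun x => g (x - u 0)) h := by
  refine ⟨?_, hk.2.1.comp_measurePreserving (measurePreserving_sub (u 0)), hk.2.2.1,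
    fun x y => ?_⟩
  · refine ((continuous_weylPhase u).comp continuous_fst).mul (hk.1.comp (?_ : Continuous
      fun z : ℝ × ℝ => (z.1 - u 0, z.2)))
    fun_prop
  · rw [displacedKernel, norm_mul, norm_weylPhase, one_mul]
    exact hk.2.2.2 _ _

theorem displacement_ae (u : Fin 2 → ℝ) (ψ : ModeSpace) :
    displacement u ψ =ᵐ[volume] weylFun u ψ :=
  MemLp.coeFn_toLp (memLp_weylFun u ψ)

theorem displacement_mul_kernelOp {k : ℝ → ℝ → ℂ} {g h : ℝ → ℝ} (hk : IsDominatedBy k g h)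
    (u : Fin 2 → ℝ) : displacement u * kernelOp hk = kernelOp (hk.displaced u) := by
  ext1 ψ
  apply Lp.ext
  rw [mul_apply_eq_comp]
  have h := (measurePreserving_sub (u 0)).quasiMeasurePreserving.ae (kernelOp_ae hk ψ)
  filter_upwards [displacement_ae u (kernelOp hk ψ), kernelOp_ae (hk.displaced u) ψ, h]
    with x h1 h2 h3
  rw [h1, h2, weylFun, h3, ← integral_const_mul]
  simp only [displacedKernel, mul_assoc]

theorem displacement_zero : displacement 0 = 1 := by
  ext1 ψ
  apply Lp.ext
  filter_upwards [displacement_ae 0 ψ] with x hx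
  rw [hx]
  simp [weylFun, weylPhase]

namespace ModeFrame

/-- The operator is split as `op (t / 2) * op (t / 2)`, to have a product of integral operators. -/
theorem hasTrace_displacement_mul_op (F : ModeFrame) {t : ℝ} (ht : 0 < t) (u : Fin 2 → ℝ) :
    HasTrace (displacement u * F.op t) (∫ x, weylPhase u x * F.kernel t (x - u 0) x) := by
  have ht2 : 0 < t / 2 := by linarith
  have h1 : displacement u * F.op t =
      kernelOp ((F.isDominatedBy_kernel ht2).displaced u) *
        kernelOp (F.isDominatedBy_kernel ht2) := by
    rw [← displacement_mul_kernelOp (F.isDominatedBy_kernel ht2), ← F.op_of_pos ht2, mul_assoc,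
      F.op_mul_op ht2 ht2, add_halves]
  rw [h1]
  convert hasTrace_kernelOp_mul ((F.isDominatedBy_kernel ht2).displaced u)
    (F.isDominatedBy_kernel ht2) using 1
  refine integral_congr_ae (Eventually.of_forall fun x => ?_)
  simp only [displacedKernel, mul_assoc]
  rw [integral_const_mul, F.integral_kernel_mul_kernel ht2 ht2, add_halves]

theorem integral_weylPhase_mul_kernel (F : ModeFrame) {t : ℝ} (ht : 0 < t) (u : Fin 2 → ℝ) :
    ∫ x, weylPhase u x * F.kernel t (x - u 0) x =
      (((2 * Real.sinh (t / 2))⁻¹ : ℝ) : ℂ) * Complex.exp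
        (((-((F.width * (u 1 - F.shear * u 0) ^ 2 + u 0 ^ 2 / F.width) /
            (4 * Real.tanh (t / 2))) : ℝ) : ℂ) + ((F.pos * u 1 - F.mom * u 0 : ℝ) : ℂ) * Complex.I) := by
  have hT := tanh_half_pos ht
  have hm := F.width_pos
  have hs := Real.sinh_pos_iff.2 ht
  have hsh : 0 < Real.sinh (t / 2) := Real.sinh_pos_iff.2 (by linarith)
  have hch := Real.cosh_pos (t / 2)
  have hA : 0 < Real.tanh (t / 2) / F.width := by positivity
  rw [← integral_add_right_eq_self (fun x => weylPhase u x * F.kernel t (x - u 0) x) (u 0 / 2)]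
  have h1 : ∀ w : ℝ, weylPhase u (w + u 0 / 2) * F.kernel t (w + u 0 / 2 - u 0) (w + u 0 / 2) =
      (((√(2 * Real.pi * F.width * Real.sinh t))⁻¹ : ℝ) : ℂ) * Complex.exp
        (-((Real.tanh (t / 2) / F.width : ℝ) : ℂ) * (w : ℂ) ^ 2 +
        (((2 * (Real.tanh (t / 2) / F.width) * F.pos : ℝ) : ℂ) +
          ((u 1 - F.shear * u 0 : ℝ) : ℂ) * Complex.I) * w +
        (((-(Real.tanh (t / 2) / F.width) * F.pos ^ 2
          - u 0 ^ 2 / (4 * Real.tanh (t / 2) * F.width) : ℝ) : ℂ) +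
          ((F.shear * u 0 * F.pos - F.mom * u 0 : ℝ) : ℂ) * Complex.I)) := by
    intro w
    rw [kernel, mehler_eq_tanh hm ht, weylPhase]
    push_cast
    rw [mul_left_comm, mul_assoc, ← Complex.exp_add, ← Complex.exp_add]
    congr 2
    unfold phase
    push_cast
    ring
  simp only [h1]
  rw [integral_const_mul, integral_cexp_quadratic_real hA, ← mul_assoc, ← Complex.ofReal_mul]
  congr 1
  · congr 1
    rw [← Real.sqrt_inv, ← Real.sqrt_mul (by positivity), Real.sqrt_eq_iff_eq_sq
      (by positivity) (by positivity), Real.tanh_eq_sinh_div_cosh, sinh_eq_two_mul t]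
    field_simp
  · congr 1
    generalize Real.tanh (t / 2) = T at *
    have hI := Complex.I_sq
    have hT' : (T : ℂ) ≠ 0 := by exact_mod_cast hT.ne'
    have hm' : (F.width : ℂ) ≠ 0 := by exact_mod_cast hm.ne'
    push_cast
    field_simp
    ring_nf
    rw [hI]
    ring

/-- The characteristic function of a Gaussian state. -/
theorem hasTrace_displacement_mul_state (F : ModeFrame) {β : ℝ} (hβ : 0 < β) (u : Fin 2 → ℝ) :
    HasTrace (displacement u * F.state β) (Complex.exp
        (((-((F.width * (u 1 - F.shear * u 0) ^ 2 + u 0 ^ 2 / F.width) /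
            (4 * Real.tanh (β / 2))) : ℝ) : ℂ) + ((F.pos * u 1 - F.mom * u 0 : ℝ) : ℂ) * Complex.I)) := by
  have hsh : 0 < Real.sinh (β / 2) := Real.sinh_pos_iff.2 (by linarith)
  have h1 := (F.hasTrace_displacement_mul_op hβ u).smul ((2 * Real.sinh (β / 2) : ℝ) : ℂ)
  rw [F.integral_weylPhase_mul_kernel hβ, ← mul_assoc, ← Complex.ofReal_mul,
    mul_inv_cancel₀ (by positivity), Complex.ofReal_one, one_mul] at h1
  have h2 : displacement u * F.state β =
      ((2 * Real.sinh (β / 2) : ℝ) : ℂ) • (displacement u * F.op β) := by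
    rw [state, mul_smul_comm, Complex.coe_smul]
    rfl
  rw [h2]
  exact h1

theorem isDensityOperator_state (F : ModeFrame) {β : ℝ} (hβ : 0 < β) :
    IsDensityOperator (F.state β) := by
  refine ⟨(ContinuousLinearMap.nonneg_iff_isPositive _).1 (F.state_nonneg hβ), ?_⟩
  have h := F.hasTrace_displacement_mul_state hβ 0
  simpa [displacement_zero] using h

/-- The frame of a squeezing by `r` along the direction `φ` and a displacement by `(q, p)`. -/
noncomputable def ofParam (r φ q p : ℝ) : ModeFrame where
  width := Real.cosh (2 * r) + Real.sinh (2 * r) * Real.cos (2 * φ)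
  shear := -(Real.sinh (2 * r) * Real.sin (2 * φ)) /
    (Real.cosh (2 * r) + Real.sinh (2 * r) * Real.cos (2 * φ))
  pos := q
  mom := p
  width_pos := by
    have h1 := Real.abs_cos_le_one (2 * φ)
    have h2 : |Real.sinh (2 * r) * Real.cos (2 * φ)| ≤ |Real.sinh (2 * r)| := by
      rw [abs_mul]
      exact mul_le_of_le_one_right (abs_nonneg _) h1
    have h3 : |Real.sinh (2 * r)| < Real.cosh (2 * r) := by
      refine abs_lt.2 ⟨?_, Real.sinh_lt_cosh _⟩
      linarith [Real.cosh_add_sinh (2 * r), Real.exp_pos (2 * r)]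
    have := neg_abs_le (Real.sinh (2 * r) * Real.cos (2 * φ))
    linarith

end ModeFrame

theorem squeezeMat_mul_transpose (r φ : ℝ) : squeezeMat r φ * (squeezeMat r φ)ᵀ =
    !![Real.cosh (2 * r) + Real.sinh (2 * r) * Real.cos (2 * φ),
        -(Real.sinh (2 * r) * Real.sin (2 * φ));
      -(Real.sinh (2 * r) * Real.sin (2 * φ)),
        Real.cosh (2 * r) - Real.sinh (2 * r) * Real.cos (2 * φ)] := by
  have h1 := Real.sin_sq_add_cos_sq φ
  have h2 : Real.exp r * Real.exp (-r) = 1 := by rw [← Real.exp_add]; simp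
  have hO : (rotMat φ)ᵀ * rotMat φ = 1 := by
    ext i j
    fin_cases i <;> fin_cases j <;> simp [rotMat, Matrix.mul_apply, Fin.sum_univ_two] <;>
      linarith
  have hS : (squeezeMat r φ)ᵀ = squeezeMat r φ := by
    have : (squeezeDiag r)ᵀ = squeezeDiag r := by
      ext i j
      fin_cases i <;> fin_cases j <;> simp [squeezeDiag]
    rw [squeezeMat, Matrix.transpose_mul, Matrix.transpose_mul, Matrix.transpose_transpose, this,
      Matrix.mul_assoc]
  have hD : squeezeDiag r * squeezeDiag r = !![Real.exp (2 * r), 0; 0, Real.exp (-(2 * r))] := by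
    ext i j
    fin_cases i <;> fin_cases j <;>
      simp [squeezeDiag, Matrix.mul_apply, Fin.sum_univ_two, ← Real.exp_add] <;> ring_nf
  have hM : squeezeMat r φ * squeezeMat r φ =
      rotMat φ * (squeezeDiag r * squeezeDiag r) * (rotMat φ)ᵀ := by
    calc _ = rotMat φ * squeezeDiag r * ((rotMat φ)ᵀ * rotMat φ) * squeezeDiag r * (rotMat φ)ᵀ := by
          simp only [squeezeMat, Matrix.mul_assoc]
      _ = _ := by rw [hO]; simp only [Matrix.mul_assoc, Matrix.mul_one]
  rw [hS, hM, hD, Real.cos_two_mul, Real.sin_two_mul, Real.cosh_eq, Real.sinh_eq]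
  generalize Real.exp (2 * r) = a
  generalize Real.exp (-(2 * r)) = b
  have h3 : Real.sin φ ^ 2 = 1 - Real.cos φ ^ 2 := by linarith
  ext i j
  fin_cases i <;> fin_cases j <;> simp [rotMat, Matrix.mul_apply, Fin.sum_univ_two] <;>
    ring_nf <;> (try rw [h3]) <;> ring

/-- Every parameter point labels the state of the corresponding frame. -/
theorem isGaussianStateAt_state (θ : Fin 5 → ℝ) (hθ : 0 < θ 0) :
    IsGaussianStateAt ((ModeFrame.ofParam (θ 1) (θ 2) (θ 3) (θ 4)).state (θ 0)) θ := by
  refine ⟨ModeFrame.isDensityOperator_state _ hθ, fun u => ?_⟩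
  convert ModeFrame.hasTrace_displacement_mul_state _ hθ u using 2
  have hT := tanh_half_pos hθ
  have hm := (ModeFrame.ofParam (θ 1) (θ 2) (θ 3) (θ 4)).width_pos
  have hcs := Real.cosh_sq (2 * θ 1)
  have hsc := Real.sin_sq_add_cos_sq (2 * θ 2)
  have h1 : u ⬝ᵥ (sympl *ᵥ ![θ 3, θ 4]) = u 0 * θ 4 - u 1 * θ 3 := by
    simp [sympl, Matrix.mulVec, dotProduct, Fin.sum_univ_two]
    ring
  have h2 : u ⬝ᵥ ((symplᵀ * covMat (θ 0) (θ 1) (θ 2) * sympl) *ᵥ u) =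
      ((ModeFrame.ofParam (θ 1) (θ 2) (θ 3) (θ 4)).width *
        (u 1 - (ModeFrame.ofParam (θ 1) (θ 2) (θ 3) (θ 4)).shear * u 0) ^ 2 +
        u 0 ^ 2 / (ModeFrame.ofParam (θ 1) (θ 2) (θ 3) (θ 4)).width) / Real.tanh (θ 0 / 2) := by
    rw [covMat, squeezeMat_mul_transpose]
    simp [sympl, Matrix.mulVec, dotProduct, Fin.sum_univ_two, Matrix.mul_apply,
      ModeFrame.ofParam] at hm ⊢
    field_simp
    have : Real.sin (2 * θ 2) ^ 2 = 1 - Real.cos (2 * θ 2) ^ 2 := by linarith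
    ring_nf
    ring_nf at hcs this
    rw [hcs, this]
    ring
  rw [h1, h2]
  push_cast
  simp only [ModeFrame.ofParam]
  field_simp
  ring

/-! ### Series of integrable functions -/

section series

variable {α ι E : Type} [MeasurableSpace α] {μ : Measure α} [NormedAddCommGroup E] {F : ι → α → E}

theorem tsum_lintegral_enorm_lt_top (hF : ∀ i, Integrable (F i) μ)
    (hsum : Summable fun i => ∫ a, ‖F i a‖ ∂μ) : ∑' i, ∫⁻ a, ‖F i a‖ₑ ∂μ < ∞ := by
  have h1 : ∀ i, ∫⁻ a, ‖F i a‖ₑ ∂μ = ENNReal.ofReal (∫ a, ‖F i a‖ ∂μ) := fun i =>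
    (ofReal_integral_norm_eq_lintegral_enorm (hF i)).symm
  simp only [h1]
  rw [← ENNReal.ofReal_tsum_of_nonneg (fun i => integral_nonneg fun _ => norm_nonneg _) hsum]
  exact ENNReal.ofReal_lt_top

variable [Countable ι]

theorem ae_summable_norm_of_summable_integral_norm (hF : ∀ i, Integrable (F i) μ)
    (hsum : Summable fun i => ∫ a, ‖F i a‖ ∂μ) : ∀ᵐ a ∂μ, Summable fun i => ‖F i a‖ := by
  have hmeas : ∀ i, AEMeasurable (fun a => ‖F i a‖ₑ) μ := fun i => (hF i).1.enorm
  have h2 : ∫⁻ a, ∑' i, ‖F i a‖ₑ ∂μ ≠ ∞ := by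
    rw [lintegral_tsum hmeas]
    exact (tsum_lintegral_enorm_lt_top hF hsum).ne
  filter_upwards [ae_lt_top' (AEMeasurable.tsum hmeas) h2] with a ha
  have h3 : Summable fun i => ‖F i a‖₊ := ENNReal.tsum_coe_ne_top_iff_summable.1 ha.ne
  exact NNReal.summable_coe.2 h3

theorem integrable_tsum_of_summable_integral_norm [CompleteSpace E] (hF : ∀ i, Integrable (F i) μ)
    (hsum : Summable fun i => ∫ a, ‖F i a‖ ∂μ) : Integrable (fun a => ∑' i, F i a) μ := by
  refine ⟨?_, ?_⟩
  · refine aestronglyMeasurable_of_tendsto_ae (atTop : Filter (Finset ι))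
      (f := fun s a => ∑ i ∈ s, F i a)
      (fun s => Finset.aestronglyMeasurable_fun_sum s fun i _ => (hF i).1) ?_
    filter_upwards [ae_summable_norm_of_summable_integral_norm hF hsum] with a ha
    exact ha.of_norm.hasSum
  · refine lt_of_le_of_lt ?_ (tsum_lintegral_enorm_lt_top hF hsum)
    rw [← lintegral_tsum fun i => (hF i).1.enorm]
    exact lintegral_mono fun a => enorm_tsum_le_tsum_enorm

end series

/-! ### Injectivity of the Fourier transform and correlations -/

open scoped FourierTransform ContDiff in
/-- An integrable function with vanishing Fourier transform vanishes: test it against Schwartz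
functions, each of which is a Fourier transform. -/
theorem ae_eq_zero_of_integral_exp_mul_eq_zero {f : ℝ → ℂ} (hf : Integrable f volume)
    (h : ∀ ξ : ℝ, ∫ x, Complex.exp (((ξ * x : ℝ) : ℂ) * Complex.I) * f x = 0) :
    ∀ᵐ x, f x = 0 := by
  refine ae_eq_zero_of_integral_contDiff_smul_eq_zero hf.locallyIntegrable fun g hg hgs => ?_
  have hg₁ : HasCompactSupport (Complex.ofRealCLM ∘ g) := hgs.comp_left rfl
  have hg₂ : ContDiff ℝ ∞ (Complex.ofRealCLM ∘ g) := by fun_prop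
  set G : SchwartzMap ℝ ℂ := hg₁.toSchwartzMap hg₂ with hG
  have hinv : 𝓕 (𝓕⁻ G) = G := FourierInvPair.fourier_fourierInv_eq G
  have h1 := VectorFourier.integral_fourierIntegral_smul_eq_flip (L := innerₗ ℝ) (μ := volume)
      (ν := volume) (f := (𝓕⁻ G : SchwartzMap ℝ ℂ)) (g := f)
      Real.continuous_fourierChar continuous_inner (SchwartzMap.integrable _) hf
  have h2 : ∀ x : ℝ, VectorFourier.fourierIntegral Real.fourierChar volume (innerₗ ℝ)
      (𝓕⁻ G : SchwartzMap ℝ ℂ) x = G x := by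
    intro x
    conv_rhs => rw [← hinv]
    rfl
  have h3 : ∀ ξ : ℝ, VectorFourier.fourierIntegral Real.fourierChar volume (innerₗ ℝ).flip f ξ
      = 0 := by
    intro ξ
    rw [← h (-2 * Real.pi * ξ)]
    unfold VectorFourier.fourierIntegral
    refine integral_congr_ae (Eventually.of_forall fun x => ?_)
    simp only [Circle.smul_def, Real.fourierChar_apply, smul_eq_mul]
    congr 3
    simp
    ring
  simp only [h2, h3, smul_zero, integral_zero] at h1
  simpa [hG] using h1

/-- Fubini for the correlation of two integrable functions. -/
theorem integral_correlation {𝕜 : Type} [RCLike 𝕜] {c a : ℝ → 𝕜} (hc : Integrable c volume)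
    (ha : Integrable a volume) :
    (∀ᵐ v, Integrable (fun t => c t * a (t - v)) volume) ∧
      Integrable (fun v => ∫ t, c t * a (t - v)) volume ∧
      ∫ v, ∫ t, c t * a (t - v) = (∫ t, c t) * ∫ t, a t := by
  have ha' : Integrable (fun y => a (-y)) volume := ha.comp_neg
  have h0 : ∀ v : ℝ, convolution c (fun y => a (-y)) (ContinuousLinearMap.mul 𝕜 𝕜) volume v
      = ∫ t, c t * a (t - v) := by
    intro v
    simp [convolution_def]
  refine ⟨?_, ?_, ?_⟩
  · filter_upwards [hc.ae_convolution_exists (ContinuousLinearMap.mul 𝕜 𝕜) ha'] with v hv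
    simpa [ConvolutionExistsAt] using hv
  · have h1 := hc.integrable_convolution (ContinuousLinearMap.mul 𝕜 𝕜) ha'
    rwa [funext h0] at h1
  · have h1 := integral_convolution (μ := volume) (ν := volume) (ContinuousLinearMap.mul 𝕜 𝕜) hc ha'
    simp only [h0, ContinuousLinearMap.mul_apply'] at h1
    rw [h1, integral_neg_eq_self]

/-! ### A density operator is determined by its characteristic function -/

theorem hasSum_norm_inner_sq {H : Type} [NormedAddCommGroup H] [InnerProductSpace ℂ H] {ι : Type}
    (b : HilbertBasis ι ℂ H) (x : H) :
    HasSum (fun i => ‖inner ℂ (b i) x‖ ^ 2) (‖x‖ ^ 2) := by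
  have h := b.hasSum_inner_mul_inner x x
  rw [inner_self_eq_norm_sq_to_K] at h
  have h2 : ∀ i, inner ℂ x (b i) * inner ℂ (b i) x = ((‖inner ℂ (b i) x‖ ^ 2 : ℝ) : ℂ) := by
    intro i
    rw [← inner_conj_symm, Complex.conj_mul']
    push_cast
    rfl
  simp only [h2] at h
  refine Complex.hasSum_ofReal.1 ?_
  rw [Complex.ofReal_pow]
  exact h

section operator

variable {H : Type} [NormedAddCommGroup H] [InnerProductSpace ℂ H] [CompleteSpace H]

theorem exists_sqrt_of_nonneg {T : H →L[ℂ] H} (hT : 0 ≤ T) :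
    ∃ R : H →L[ℂ] H, (∀ x y, inner ℂ (R x) y = inner ℂ x (R y)) ∧ R * R = T := by
  refine ⟨CFC.sqrt T, fun x y => ?_, CFC.sqrt_mul_sqrt_self T hT⟩
  have h : star (CFC.sqrt T) = CFC.sqrt T := (IsSelfAdjoint.of_nonneg (CFC.sqrt_nonneg T)).star_eq
  nth_rw 1 [← h]
  rw [ContinuousLinearMap.star_eq_adjoint, ContinuousLinearMap.adjoint_inner_left]

/-- Cyclicity of the trace, for the square root `R` of a trace class operator. -/
theorem hasSum_inner_sqrt {R D : H →L[ℂ] H} (hR : ∀ x y, inner ℂ (R x) y = inner ℂ x (R y))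
    {ι : Type} (b : HilbertBasis ι ℂ H) (hsum : Summable fun i => ‖R (b i)‖ ^ 2) {t : ℂ}
    (ht : HasSum (fun i => inner ℂ (b i) (D (R (R (b i))))) t) :
    HasSum (fun i => inner ℂ (R (b i)) (D (R (b i)))) t := by
  set a : ι × ι → ℂ := fun z => inner ℂ (b z.1) (D (R (b z.2))) * inner ℂ (b z.2) (R (b z.1))
    with ha
  have hrow : ∀ i, HasSum (fun j => a (i, j)) (inner ℂ (b i) (D (R (R (b i))))) := by
    intro i
    have h1 : ∀ y, inner ℂ (ContinuousLinearMap.adjoint (D * R) (b i)) y =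
        inner ℂ (b i) (D (R y)) := fun y => by
      rw [ContinuousLinearMap.adjoint_inner_left, mul_apply_eq_comp]
    have h2 := b.hasSum_inner_mul_inner (ContinuousLinearMap.adjoint (D * R) (b i)) (R (b i))
    simpa only [h1] using h2
  have hcol : ∀ j, HasSum (fun i => a (i, j)) (inner ℂ (R (b j)) (D (R (b j)))) := by
    intro j
    have h2 := b.hasSum_inner_mul_inner (R (b j)) (D (R (b j)))
    simp only [hR (b j)] at h2
    rw [← hR] at h2
    refine h2.congr_fun fun i => ?_
    rw [ha, mul_comm]
  have hsq : ∀ A : H →L[ℂ] H, (Summable fun j => ‖A (b j)‖ ^ 2) →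
      Summable fun z : ι × ι => ‖inner ℂ (b z.1) (A (b z.2))‖ ^ 2 := by
    intro A hA
    have h1 : Summable fun z : ι × ι => ‖inner ℂ (b z.2) (A (b z.1))‖ ^ 2 := by
      refine (summable_prod_of_nonneg fun _ => by positivity).2 ⟨fun j => ?_, ?_⟩
      · exact (hasSum_norm_inner_sq b (A (b j))).summable
      · simpa only [(hasSum_norm_inner_sq b (A (b _))).tsum_eq] using hA
    exact (Equiv.prodComm ι ι).summable_iff.2 h1
  have hDR : Summable fun j => ‖(D * R) (b j)‖ ^ 2 := by
    refine Summable.of_nonneg_of_le (fun _ => by positivity) (fun j => ?_)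
      (hsum.mul_left (‖D‖ ^ 2))
    rw [mul_apply_eq_comp, ← mul_pow]
    exact pow_le_pow_left₀ (norm_nonneg _) (D.le_opNorm _) 2
  have hsuma : Summable a := by
    refine Summable.of_norm_bounded ((hsq _ hDR).add ((Equiv.prodComm ι ι).summable_iff.2
      (hsq _ hsum))) fun z => ?_
    simp only [ha, norm_mul, mul_apply_eq_comp, Function.comp_apply, Equiv.prodComm_apply,
      Prod.fst_swap, Prod.snd_swap]
    nlinarith [sq_nonneg (‖inner ℂ (b z.1) (D (R (b z.2)))‖ - ‖inner ℂ (b z.2) (R (b z.1))‖),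
      sq_nonneg (‖inner ℂ (b z.1) (D (R (b z.2)))‖), sq_nonneg (‖inner ℂ (b z.2) (R (b z.1))‖)]
  obtain ⟨T, hT⟩ := hsuma
  have hTt : T = t := (hT.prod_fiberwise hrow).unique ht
  rw [← hTt]
  exact ((Equiv.prodComm ι ι).hasSum_iff.2 hT).prod_fiberwise hcol

end operator

/-- The correlation density `∑ᵢ conj (ψᵢ x) ψᵢ (x - v)` of a family of wave functions. -/
noncomputable def correlation {ι : Type} (ψ : ι → ModeSpace) (v x : ℝ) : ℂ :=
  ∑' i, starRingEnd ℂ (ψ i x) * ψ i (x - v)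

section correlation

variable {ι : Type} {ψ : ι → ModeSpace}

theorem memLp_shift (φ : ModeSpace) (v : ℝ) : MemLp (fun x => φ (x - v)) 2 volume :=
  (Lp.memLp φ).comp_measurePreserving (measurePreserving_sub v)

theorem integral_norm_mul_norm_le {f g : ℝ → ℂ} (hf : MemLp f 2 volume) (hg : MemLp g 2 volume) :
    ∫ x, ‖f x‖ * ‖g x‖ ≤ ‖hf.toLp f‖ * ‖hg.toLp g‖ := by
  have h1 := integral_abs_mul_norm_sq_le hf.norm (hg.toLp g)
  have h2 : ∫ y, |‖f y‖| * ‖(hg.toLp g : ModeSpace) y‖ = ∫ x, ‖f x‖ * ‖g x‖ := by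
    apply integral_congr_ae
    filter_upwards [hg.coeFn_toLp] with x hx
    rw [hx, abs_norm]
  rw [h2, ← eLpNorm_toReal_sq hf, ← Lp.norm_toLp f hf, ← mul_pow] at h1
  exact (abs_le_of_sq_le_sq' h1 (by positivity)).2

theorem integrable_correlation_term (ψ : ι → ModeSpace) (v : ℝ) (i : ι) :
    Integrable (fun x => starRingEnd ℂ (ψ i x) * ψ i (x - v)) volume :=
  (memLp_conj (Lp.memLp (ψ i))).integrable_mul (memLp_shift (ψ i) v)

theorem summable_correlation_term (hψ : Summable fun i => ‖ψ i‖ ^ 2) (v : ℝ) :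
    Summable fun i => ∫ x, ‖starRingEnd ℂ (ψ i x) * ψ i (x - v)‖ := by
  refine Summable.of_nonneg_of_le (fun _ => integral_nonneg fun _ => norm_nonneg _) (fun i => ?_) hψ
  simp only [norm_mul, RCLike.norm_conj]
  refine (integral_norm_mul_norm_le (Lp.memLp (ψ i)) (memLp_shift (ψ i) v)).trans (le_of_eq ?_)
  rw [Lp.toLp_coeFn, sq]
  congr 1
  rw [Lp.norm_toLp, Lp.norm_def]
  congr 1
  exact eLpNorm_comp_measurePreserving (Lp.aestronglyMeasurable (ψ i)) (measurePreserving_sub v)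

variable [Countable ι]

theorem integrable_correlation (hψ : Summable fun i => ‖ψ i‖ ^ 2) (v : ℝ) :
    Integrable (correlation ψ v) volume :=
  integrable_tsum_of_summable_integral_norm (integrable_correlation_term ψ v)
    (summable_correlation_term hψ v)

/-- The Fourier transform of the correlation density is the characteristic function. -/
theorem integral_exp_mul_correlation (hψ : Summable fun i => ‖ψ i‖ ^ 2) (v ξ : ℝ) {t : ℂ}
    (ht : HasSum (fun i => inner ℂ (ψ i) (displacement ![v, ξ] (ψ i))) t) :
    ∫ x, Complex.exp (((ξ * x : ℝ) : ℂ) * Complex.I) * correlation ψ v x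
      = Complex.exp (((v * ξ / 2 : ℝ) : ℂ) * Complex.I) * t := by
  set F : ι → ℝ → ℂ := fun i x => Complex.exp (((ξ * x : ℝ) : ℂ) * Complex.I) *
    (starRingEnd ℂ (ψ i x) * ψ i (x - v)) with hF
  have hnorm : ∀ i x, ‖F i x‖ = ‖starRingEnd ℂ (ψ i x) * ψ i (x - v)‖ := fun i x => by
    rw [hF, norm_mul, Complex.norm_exp_ofReal_mul_I, one_mul]
  have hint : ∀ i, Integrable (F i) volume := fun i => by
    refine (integrable_correlation_term ψ v i).bdd_mul (c := 1) ?_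
      (Eventually.of_forall fun x => ?_)
    · exact (by fun_prop : Continuous fun x : ℝ =>
        Complex.exp (((ξ * x : ℝ) : ℂ) * Complex.I)).aestronglyMeasurable
    · rw [Complex.norm_exp_ofReal_mul_I]
  have hsum : Summable fun i => ∫ x, ‖F i x‖ := by
    simpa only [hnorm] using summable_correlation_term hψ v
  have h1 := hasSum_integral_of_summable_integral_norm hint hsum
  have h2 : ∀ i, ∫ x, F i x = Complex.exp (((v * ξ / 2 : ℝ) : ℂ) * Complex.I) *
      inner ℂ (ψ i) (displacement ![v, ξ] (ψ i)) := by
    intro i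
    rw [L2.inner_def, ← integral_const_mul]
    apply integral_congr_ae
    filter_upwards [displacement_ae ![v, ξ] (ψ i)] with x hx
    rw [hx, RCLike.inner_apply, weylFun, weylPhase]
    have h3 : Complex.exp (((ξ * x : ℝ) : ℂ) * Complex.I) =
        Complex.exp (((v * ξ / 2 : ℝ) : ℂ) * Complex.I) *
        Complex.exp (((![v, ξ] 1 * x - ![v, ξ] 0 * ![v, ξ] 1 / 2 : ℝ) : ℂ) * Complex.I) := by
      rw [← Complex.exp_add]
      congr 1
      simp
      ring
    simp only [hF]
    rw [h3]
    simp only [Matrix.cons_val_zero]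
    ring
  simp only [h2] at h1
  rw [← h1.unique (ht.mul_left _)]
  refine integral_congr_ae (Eventually.of_forall fun x => ?_)
  simp only [hF, correlation]
  rw [tsum_mul_left]

/-- The matrix elements of `∑ᵢ |ψᵢ⟩⟨ψᵢ|` in terms of the correlation density. -/
theorem hasSum_inner_mul_inner_correlation (hψ : Summable fun i => ‖ψ i‖ ^ 2) (f g : ModeSpace) :
    HasSum (fun i => inner ℂ f (ψ i) * inner ℂ (ψ i) g)
      (∫ v, ∫ x, g x * starRingEnd ℂ (f (x - v)) * correlation ψ v x) := by
  set c : ι → ℝ → ℂ := fun i x => starRingEnd ℂ (ψ i x) * g x with hc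
  set a : ι → ℝ → ℂ := fun i x => starRingEnd ℂ (f x) * ψ i x with ha
  have hci : ∀ i, Integrable (c i) volume := fun i =>
    (memLp_conj (Lp.memLp (ψ i))).integrable_mul (Lp.memLp g)
  have hai : ∀ i, Integrable (a i) volume := fun i =>
    (memLp_conj (Lp.memLp f)).integrable_mul (Lp.memLp (ψ i))
  have hcn : ∀ i, ∫ x, ‖c i x‖ ≤ ‖ψ i‖ * ‖g‖ := fun i => by
    have := integral_norm_mul_norm_le (Lp.memLp (ψ i)) (Lp.memLp g)
    simpa [hc] using this
  have han : ∀ i, ∫ x, ‖a i x‖ ≤ ‖f‖ * ‖ψ i‖ := fun i => by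
    have := integral_norm_mul_norm_le (Lp.memLp f) (Lp.memLp (ψ i))
    simpa [ha] using this
  -- the correlations of the norms
  set N : ι → ℝ → ℝ := fun i v => ∫ t, ‖c i t‖ * ‖a i (t - v)‖ with hN
  have hN0 : ∀ i v, 0 ≤ N i v := fun i v => integral_nonneg fun _ => by positivity
  have hNint : ∀ i, Integrable (N i) volume := fun i =>
    (integral_correlation (hci i).norm (hai i).norm).2.1
  have hNsum : Summable fun i => ∫ v, N i v := by
    refine Summable.of_nonneg_of_le (fun i => integral_nonneg fun v => hN0 i v) (fun i => ?_)
      (hψ.mul_left (‖f‖ * ‖g‖))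
    rw [(integral_correlation (hci i).norm (hai i).norm).2.2]
    calc _ ≤ (‖ψ i‖ * ‖g‖) * (‖f‖ * ‖ψ i‖) := by
          refine mul_le_mul (hcn i) (han i) (integral_nonneg fun _ => norm_nonneg _) (by positivity)
      _ = _ := by ring
  set T : ι → ℝ → ℂ := fun i v => ∫ t, c i t * a i (t - v) with hT
  have hTint : ∀ i, Integrable (T i) volume := fun i => (integral_correlation (hci i) (hai i)).2.1
  have hTN : ∀ i v, ‖T i v‖ ≤ N i v := fun i v => by
    refine (norm_integral_le_integral_norm _).trans (le_of_eq ?_)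
    simp only [norm_mul, hN]
  have hTsum : Summable fun i => ∫ v, ‖T i v‖ :=
    Summable.of_nonneg_of_le (fun i => integral_nonneg fun _ => norm_nonneg _)
      (fun i => integral_mono (hTint i).norm (hNint i) (hTN i)) hNsum
  have h1 := hasSum_integral_of_summable_integral_norm hTint hTsum
  have h2 : ∀ i, ∫ v, T i v = inner ℂ f (ψ i) * inner ℂ (ψ i) g := by
    intro i
    rw [(integral_correlation (hci i) (hai i)).2.2, mul_comm, L2.inner_def, L2.inner_def]
    simp only [RCLike.inner_apply, hc, ha]
    congr 1 <;> refine integral_congr_ae (Eventually.of_forall fun x => ?_) <;>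
      simp only [mul_comm]
  simp only [h2] at h1
  suffices h : ∫ v, ∫ x, g x * starRingEnd ℂ (f (x - v)) * correlation ψ v x = ∫ v, ∑' i, T i v by
    rw [h]
    exact h1
  apply integral_congr_ae
  have hNae := ae_summable_norm_of_summable_integral_norm (F := N) hNint
    (by simpa only [Real.norm_of_nonneg (hN0 _ _)] using hNsum)
  have hex : ∀ᵐ v, ∀ i, Integrable (fun t => c i t * a i (t - v)) volume :=
    ae_all_iff.2 fun i => (integral_correlation (hci i) (hai i)).1
  filter_upwards [hNae, hex] with v hv hv'
  have h3 := hasSum_integral_of_summable_integral_norm hv' (by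
    simpa only [Real.norm_of_nonneg (hN0 _ _), norm_mul] using hv)
  rw [h3.tsum_eq]
  refine integral_congr_ae (Eventually.of_forall fun x => ?_)
  simp only [correlation, hc, ha]
  rw [← tsum_mul_left]
  refine tsum_congr fun i => ?_
  ring

end correlation

/-- The functions `F v` are the correlation densities of the vectors `R (b i)`, where `R * R = ρ`
and `b` is an orthonormal basis. Their Fourier transforms are given by the characteristic function, and
they determine all matrix elements of `ρ`. -/
theorem IsDensityOperator.exists_correlation {ρ : ModeSpace →L[ℂ] ModeSpace}
    (hρ : IsDensityOperator ρ) {χ : (Fin 2 → ℝ) → ℂ}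
    (hχ : ∀ u, HasTrace (displacement u * ρ) (χ u)) :
    ∃ F : ℝ → ℝ → ℂ, (∀ v, Integrable (F v) volume) ∧
      (∀ v ξ : ℝ, ∫ x, Complex.exp (((ξ * x : ℝ) : ℂ) * Complex.I) * F v x
        = Complex.exp (((v * ξ / 2 : ℝ) : ℂ) * Complex.I) * χ ![v, ξ]) ∧
      ∀ f g : ModeSpace, inner ℂ f (ρ g) = ∫ v, ∫ x, g x * starRingEnd ℂ (f (x - v)) * F v x := by
  obtain ⟨w, b, -⟩ := exists_hilbertBasis ℂ ModeSpace
  have : Fact ((2 : ℝ≥0∞) ≠ ∞) := ⟨ENNReal.ofNat_ne_top⟩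
  have : Countable w := countable_of_hilbertBasis b
  obtain ⟨R, hR, hRR⟩ := exists_sqrt_of_nonneg
    ((ContinuousLinearMap.nonneg_iff_isPositive ρ).2 hρ.isPositive)
  have happ : ∀ x, ρ x = R (R x) := fun x => by rw [← hRR, mul_apply_eq_comp]
  have hsum : Summable fun i => ‖R (b i)‖ ^ 2 := by
    have h1 := (hρ.hasTrace _ b).summable
    have h2 : ∀ i, inner ℂ (b i) (ρ (b i)) = ((‖R (b i)‖ ^ 2 : ℝ) : ℂ) := fun i => by
      rw [happ, ← hR, inner_self_eq_norm_sq_to_K]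
      push_cast
      rfl
    simp only [h2] at h1
    exact_mod_cast h1
  refine ⟨correlation fun i => R (b i), integrable_correlation hsum, fun v ξ => ?_, fun f g => ?_⟩
  · refine integral_exp_mul_correlation hsum v ξ (hasSum_inner_sqrt hR b hsum ?_)
    have h1 := hχ ![v, ξ] _ b
    simpa only [mul_apply_eq_comp, happ] using h1
  · have h1 := b.hasSum_inner_mul_inner (R f) (R g)
    simp only [hR f, ← hR (b _), ← happ] at h1
    exact h1.unique (hasSum_inner_mul_inner_correlation hsum f g)

theorem IsDensityOperator.eq_of_charFun {ρ ρ' : ModeSpace →L[ℂ] ModeSpace}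
    (hρ : IsDensityOperator ρ) (hρ' : IsDensityOperator ρ') {χ : (Fin 2 → ℝ) → ℂ}
    (hχ : ∀ u, HasTrace (displacement u * ρ) (χ u))
    (hχ' : ∀ u, HasTrace (displacement u * ρ') (χ u)) : ρ = ρ' := by
  obtain ⟨F, hF, hFχ, hFρ⟩ := hρ.exists_correlation hχ
  obtain ⟨F', hF', hFχ', hFρ'⟩ := hρ'.exists_correlation hχ'
  have hcont : ∀ ξ : ℝ, Continuous fun x : ℝ => Complex.exp (((ξ * x : ℝ) : ℂ) * Complex.I) :=
    fun ξ => by fun_prop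
  have hbdd : ∀ (ξ : ℝ) {f : ℝ → ℂ}, Integrable f volume →
      Integrable (fun x => Complex.exp (((ξ * x : ℝ) : ℂ) * Complex.I) * f x) volume := by
    intro ξ f hf
    refine hf.bdd_mul (c := 1) (hcont ξ).aestronglyMeasurable (Eventually.of_forall fun x => ?_)
    rw [Complex.norm_exp_ofReal_mul_I]
  have hFF' : ∀ v, ∀ᵐ x, F v x = F' v x := by
    intro v
    have h0 := ae_eq_zero_of_integral_exp_mul_eq_zero ((hF v).sub (hF' v)) fun ξ => by
      simp only [Pi.sub_apply, mul_sub]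
      rw [integral_sub (hbdd ξ (hF v)) (hbdd ξ (hF' v)), hFχ, hFχ', sub_self]
    filter_upwards [h0] with x hx
    exact sub_eq_zero.1 hx
  refine ContinuousLinearMap.ext fun g => ext_inner_left ℂ fun f => ?_
  rw [hFρ, hFρ']
  refine integral_congr_ae (Eventually.of_forall fun v => integral_congr_ae ?_)
  filter_upwards [hFF' v] with x hx
  rw [hx]

/-- A Gaussian state is determined by its parameter point. -/
theorem IsGaussianStateAt.eq_state {ρ : ModeSpace →L[ℂ] ModeSpace} {θ : Fin 5 → ℝ} (hθ : 0 < θ 0)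
    (h : IsGaussianStateAt ρ θ) :
    ρ = (ModeFrame.ofParam (θ 1) (θ 2) (θ 3) (θ 4)).state (θ 0) :=
  h.isDensityOperator.eq_of_charFun (isGaussianStateAt_state θ hθ).isDensityOperator h.charFun
    (isGaussianStateAt_state θ hθ).charFun

/-! ### The traces `tr (ρ₀ ^ s ρ₁ ^ (1 - s))` of Gaussian states -/

theorem sinh_half_pos {β : ℝ} (hβ : 0 < β) : 0 < Real.sinh (β / 2) :=
  Real.sinh_pos_iff.2 (by linarith)

theorem convexComb_pos {β₀ β₁ s : ℝ} (hβ₀ : 0 < β₀) (hβ₁ : 0 < β₁) (hs : s ∈ Set.Icc (0 : ℝ) 1) :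
    0 < s * β₀ + (1 - s) * β₁ := by
  rcases hs.1.eq_or_lt with h | h
  · rw [← h]
    linarith
  · have := mul_pos h hβ₀
    have := mul_nonneg (sub_nonneg.2 hs.2) hβ₁.le
    linarith

namespace ModeFrame

/-- The value of `tr (ρ₀ ^ s ρ₁ ^ (1 - s))` for two Gaussian states. -/
noncomputable def chernoffValue (F G : ModeFrame) (β₀ β₁ s : ℝ) : ℝ :=
  (2 * Real.sinh (β₀ / 2)) ^ s * (2 * Real.sinh (β₁ / 2)) ^ (1 - s) *
    ((2 * √(F.overlapDet G (s * β₀) ((1 - s) * β₁)))⁻¹ *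
      Real.exp (-F.overlapExponent G (s * β₀) ((1 - s) * β₁)))

theorem overlapDet_pos (F G : ModeFrame) {β₀ β₁ s : ℝ} (hβ₀ : 0 < β₀) (hβ₁ : 0 < β₁)
    (hs : s ∈ Set.Icc (0 : ℝ) 1) : 0 < F.overlapDet G (s * β₀) ((1 - s) * β₁) := by
  refine lt_of_lt_of_le ?_ (F.sinh_half_sq_le_overlapDet G (mul_nonneg hs.1 hβ₀.le)
    (mul_nonneg (sub_nonneg.2 hs.2) hβ₁.le))
  have := sinh_half_pos (convexComb_pos hβ₀ hβ₁ hs)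
  positivity

theorem chernoffValue_pos (F G : ModeFrame) {β₀ β₁ s : ℝ} (hβ₀ : 0 < β₀) (hβ₁ : 0 < β₁)
    (hs : s ∈ Set.Icc (0 : ℝ) 1) : 0 < F.chernoffValue G β₀ β₁ s := by
  have h1 := F.overlapDet_pos G hβ₀ hβ₁ hs
  have h2 := sinh_half_pos hβ₀
  have h3 := sinh_half_pos hβ₁
  unfold chernoffValue
  positivity

theorem chernoffValue_zero (F G : ModeFrame) (β₀ : ℝ) {β₁ : ℝ} (hβ₁ : 0 < β₁) :
    F.chernoffValue G β₀ β₁ 0 = 1 := by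
  have h3 := sinh_half_pos hβ₁
  simp [chernoffValue, overlapDet, overlapExponent, Real.sqrt_sq h3.le]
  field_simp

theorem chernoffValue_one (F G : ModeFrame) {β₀ : ℝ} (β₁ : ℝ) (hβ₀ : 0 < β₀) :
    F.chernoffValue G β₀ β₁ 1 = 1 := by
  have h3 := sinh_half_pos hβ₀
  simp [chernoffValue, overlapDet, overlapExponent, Real.sqrt_sq h3.le]
  field_simp

/-- For `s = 0` and `s = 1` one of the two powers is the identity and the trace is that of a density
operator. For the other `s` both powers are integral operators. -/
theorem hasTrace_chernoffProduct (F G : ModeFrame) {β₀ β₁ s : ℝ} (hβ₀ : 0 < β₀) (hβ₁ : 0 < β₁)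
    (hs : s ∈ Set.Icc (0 : ℝ) 1) :
    HasTrace (chernoffProduct (F.state β₀) (G.state β₁) s) (F.chernoffValue G β₀ β₁ s : ℂ) := by
  rw [chernoffProduct_eq]
  rcases hs.1.eq_or_lt with h0 | h0
  · rw [← h0, opPow_zero (F.state_nonneg hβ₀), one_mul, sub_zero, opPow_one (G.state_nonneg hβ₁),
      F.chernoffValue_zero G β₀ hβ₁, Complex.ofReal_one]
    exact (G.isDensityOperator_state hβ₁).hasTrace
  rcases hs.2.eq_or_lt with h1 | h1
  · rw [h1, opPow_one (F.state_nonneg hβ₀), sub_self, opPow_zero (G.state_nonneg hβ₁), mul_one,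
      F.chernoffValue_one G β₁ hβ₀, Complex.ofReal_one]
    exact (F.isDensityOperator_state hβ₀).hasTrace
  rw [F.opPow_state hβ₀ h0, G.opPow_state hβ₁ (sub_pos.2 h1)]
  have h2 := (F.hasTrace_op_mul_op G (mul_pos h0 hβ₀) (mul_pos (sub_pos.2 h1) hβ₁)).smul
    (((2 * Real.sinh (β₀ / 2)) ^ s * (2 * Real.sinh (β₁ / 2)) ^ (1 - s) : ℝ) : ℂ)
  rw [← Complex.ofReal_mul] at h2
  have h3 : (2 * Real.sinh (β₀ / 2)) ^ s • F.op (s * β₀) *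
      (2 * Real.sinh (β₁ / 2)) ^ (1 - s) • G.op ((1 - s) * β₁) =
      (((2 * Real.sinh (β₀ / 2)) ^ s * (2 * Real.sinh (β₁ / 2)) ^ (1 - s) : ℝ) : ℂ) •
        (F.op (s * β₀) * G.op ((1 - s) * β₁)) := by
    rw [smul_mul_smul_comm, Complex.coe_smul]
    rfl
  rw [h3]
  exact h2

theorem continuousOn_chernoffValue (F G : ModeFrame) {β₀ β₁ : ℝ} (hβ₀ : 0 < β₀) (hβ₁ : 0 < β₁) :
    ContinuousOn (F.chernoffValue G β₀ β₁) (Set.Icc 0 1) := by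
  have h2 := sinh_half_pos hβ₀
  have h3 := sinh_half_pos hβ₁
  have hdet : Continuous fun s : ℝ => F.overlapDet G (s * β₀) ((1 - s) * β₁) := by
    unfold overlapDet
    fun_prop
  have hpow : Continuous fun s : ℝ =>
      (2 * Real.sinh (β₀ / 2)) ^ s * (2 * Real.sinh (β₁ / 2)) ^ (1 - s) := by
    refine (Real.continuous_const_rpow (by positivity)).mul
      ((Real.continuous_const_rpow (by positivity)).comp
        (by fun_prop : Continuous fun s : ℝ => 1 - s))
  refine hpow.continuousOn.mul (ContinuousOn.mul ?_ (Real.continuous_exp.comp_continuousOn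
    (ContinuousOn.neg ?_)))
  · refine ContinuousOn.inv₀ (continuous_const.mul hdet.sqrt).continuousOn fun s hs => ?_
    have := F.overlapDet_pos G hβ₀ hβ₁ hs
    positivity
  · unfold overlapExponent
    refine ContinuousOn.div (by fun_prop) (continuous_const.mul hdet).continuousOn fun s hs => ?_
    have := F.overlapDet_pos G hβ₀ hβ₁ hs
    positivity

theorem chernoffTrace_state (F G : ModeFrame) {β₀ β₁ s : ℝ} (hβ₀ : 0 < β₀) (hβ₁ : 0 < β₁)
    (hs : s ∈ Set.Icc (0 : ℝ) 1) :
    chernoffTrace (F.state β₀) (G.state β₁) s = F.chernoffValue G β₀ β₁ s := by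
  rw [chernoffTrace, (F.hasTrace_chernoffProduct G hβ₀ hβ₁ hs).opTrace_eq, Complex.ofReal_re]

theorem exists_isMinOn_chernoffValue (F G : ModeFrame) {β₀ β₁ : ℝ} (hβ₀ : 0 < β₀) (hβ₁ : 0 < β₁) :
    ∃ s ∈ Set.Icc (0 : ℝ) 1, IsMinOn (F.chernoffValue G β₀ β₁) (Set.Icc (0 : ℝ) 1) s :=
  isCompact_Icc.exists_isMinOn (Set.nonempty_Icc.2 zero_le_one)
    (F.continuousOn_chernoffValue G hβ₀ hβ₁)

theorem exists_isMinOn_chernoffTrace (F G : ModeFrame) {β₀ β₁ : ℝ} (hβ₀ : 0 < β₀) (hβ₁ : 0 < β₁) :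
    ∃ s ∈ Set.Icc (0 : ℝ) 1, IsMinOn (fun s => chernoffTrace (F.state β₀) (G.state β₁) s)
      (Set.Icc (0 : ℝ) 1) s := by
  obtain ⟨s, hs, hmin⟩ := F.exists_isMinOn_chernoffValue G hβ₀ hβ₁
  refine ⟨s, hs, fun t ht => ?_⟩
  simp only [Set.mem_ofPred_eq]
  rw [F.chernoffTrace_state G hβ₀ hβ₁ hs, F.chernoffTrace_state G hβ₀ hβ₁ ht]
  exact hmin ht

/-- Both distinguishability measures are given by the minimizing exponent. -/
theorem exists_chernoff_eq (F G : ModeFrame) {β₀ β₁ : ℝ} (hβ₀ : 0 < β₀) (hβ₁ : 0 < β₁) :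
    ∃ s ∈ Set.Icc (0 : ℝ) 1, (∀ t ∈ Set.Icc (0 : ℝ) 1,
        -Real.log (F.chernoffValue G β₀ β₁ t) ≤ -Real.log (F.chernoffValue G β₀ β₁ s)) ∧
      chernoffInformation (F.state β₀) (G.state β₁) = -Real.log (F.chernoffValue G β₀ β₁ s) ∧
      chernoffQ (F.state β₀) (G.state β₁)
        = Real.exp (-chernoffInformation (F.state β₀) (G.state β₁)) := by
  obtain ⟨s, hs, hmin⟩ := F.exists_isMinOn_chernoffValue G hβ₀ hβ₁
  have hlog : ∀ t ∈ Set.Icc (0 : ℝ) 1,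
      Real.log (F.chernoffValue G β₀ β₁ s) ≤ Real.log (F.chernoffValue G β₀ β₁ t) := fun t ht =>
    Real.log_le_log (F.chernoffValue_pos G hβ₀ hβ₁ hs) (hmin ht)
  have h1 : chernoffInformation (F.state β₀) (G.state β₁)
      = -Real.log (F.chernoffValue G β₀ β₁ s) := by
    rw [chernoffInformation]
    congr 1
    refine IsLeast.csInf_eq ⟨⟨s, hs, ?_⟩, ?_⟩
    · simp only [F.chernoffTrace_state G hβ₀ hβ₁ hs]
    · rintro _ ⟨t, ht, rfl⟩
      simp only [F.chernoffTrace_state G hβ₀ hβ₁ ht]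
      exact hlog t ht
  refine ⟨s, hs, fun t ht => neg_le_neg (hlog t ht), h1, ?_⟩
  rw [h1, neg_neg, Real.exp_log (F.chernoffValue_pos G hβ₀ hβ₁ hs), chernoffQ]
  refine IsLeast.csInf_eq ⟨⟨s, hs, ?_⟩, ?_⟩
  · simp only [F.chernoffTrace_state G hβ₀ hβ₁ hs]
  · rintro _ ⟨t, ht, rfl⟩
    simp only [F.chernoffTrace_state G hβ₀ hβ₁ ht]
    exact hmin ht

end ModeFrame

/-! ### Bounds that are uniform in the exponent -/

/-- The Jensen gap of the concave function `x ↦ log (sinh (x / 2))`. It is the classical Chernoff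
exponent of two geometric distributions. -/
noncomputable def thermalGap (x y s : ℝ) : ℝ :=
  Real.log (Real.sinh ((s * x + (1 - s) * y) / 2))
    - (s * Real.log (Real.sinh (x / 2)) + (1 - s) * Real.log (Real.sinh (y / 2)))

theorem hasDerivAt_log_sinh_half {x : ℝ} (hx : 0 < x) :
    HasDerivAt (fun x => Real.log (Real.sinh (x / 2)))
      (Real.cosh (x / 2) / Real.sinh (x / 2) / 2) x := by
  have h1 : HasDerivAt (fun x : ℝ => x / 2) (1 / 2) x := (hasDerivAt_id x).div_const 2
  refine (h1.sinh.log (sinh_half_pos hx).ne').congr_deriv ?_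
  ring

theorem hasDerivAt_coth_half {x : ℝ} (hx : 0 < x) :
    HasDerivAt (fun x => Real.cosh (x / 2) / Real.sinh (x / 2) / 2)
      (-(1 / (4 * Real.sinh (x / 2) ^ 2))) x := by
  have h0 := (sinh_half_pos hx).ne'
  have h1 : HasDerivAt (fun x : ℝ => x / 2) (1 / 2) x := (hasDerivAt_id x).div_const 2
  refine ((h1.cosh.div h1.sinh h0).div_const 2).congr_deriv ?_
  have h2 := Real.cosh_sq (x / 2)
  field_simp
  rw [h2]
  ring

theorem sq_sinh_half_le {x y : ℝ} (hx : 0 < x) (hxy : x ≤ y) :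
    Real.sinh (x / 2) ^ 2 ≤ Real.sinh (y / 2) ^ 2 :=
  pow_le_pow_left₀ (sinh_half_pos hx).le (Real.sinh_le_sinh.2 (by linarith)) 2

/-- The second derivative of `log (sinh (x / 2))` is `-1 / (4 sinh² (x / 2))`, which is increasing.
Adding the quadratic function whose second derivative cancels its value at `lo` gives a convex
function on `[lo, ∞)`, and the bound is Jensen's inequality for it. -/
theorem thermalGap_le {lo x y s : ℝ} (hlo : 0 < lo) (hx : lo ≤ x) (hy : lo ≤ y)
    (hs : s ∈ Set.Icc (0 : ℝ) 1) :
    thermalGap x y s ≤ s * (1 - s) * (x - y) ^ 2 / (8 * Real.sinh (lo / 2) ^ 2) := by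
  set C := 1 / (4 * Real.sinh (lo / 2) ^ 2) with hC
  have hlo' := sinh_half_pos hlo
  have hpos : ∀ z ∈ interior (Set.Ici lo), 0 < z := fun z hz => by
    rw [interior_Ici] at hz
    exact hlo.trans hz
  have hconv : ConvexOn ℝ (Set.Ici lo)
      (fun z => Real.log (Real.sinh (z / 2)) + C / 2 * z ^ 2) := by
    refine convexOn_of_hasDerivWithinAt2_nonneg (convex_Ici lo)
      (f' := fun z => Real.cosh (z / 2) / Real.sinh (z / 2) / 2 + C * z)
      (f'' := fun z => -(1 / (4 * Real.sinh (z / 2) ^ 2)) + C) ?_ ?_ ?_ ?_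
    · intro z hz
      have hz0 : 0 < z := hlo.trans_le hz
      exact ((hasDerivAt_log_sinh_half hz0).continuousAt.add (by fun_prop)).continuousWithinAt
    · intro z hz
      have h1 : HasDerivAt (fun z : ℝ => C / 2 * z ^ 2) (C * z) z :=
        ((hasDerivAt_pow 2 z).const_mul (C / 2)).congr_deriv (by push_cast; ring)
      exact ((hasDerivAt_log_sinh_half (hpos z hz)).add h1).hasDerivWithinAt
    · intro z hz
      have h1 : HasDerivAt (fun z : ℝ => C * z) C z :=
        ((hasDerivAt_id z).const_mul C).congr_deriv (by ring)
      exact ((hasDerivAt_coth_half (hpos z hz)).add h1).hasDerivWithinAt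
    · intro z hz
      have hz' : lo ≤ z := interior_subset hz
      have : 1 / (4 * Real.sinh (z / 2) ^ 2) ≤ C :=
        one_div_le_one_div_of_le (by positivity) (by linarith [sq_sinh_half_le hlo hz'])
      linarith
  have h := hconv.2 hx hy hs.1 (sub_nonneg.2 hs.2) (by ring)
  simp only [smul_eq_mul] at h
  have h2 : s * (1 - s) * (x - y) ^ 2 / (8 * Real.sinh (lo / 2) ^ 2)
      = C / 2 * (s * x ^ 2 + (1 - s) * y ^ 2 - (s * x + (1 - s) * y) ^ 2) := by
    rw [hC]
    field_simp
    ring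
  rw [h2, thermalGap]
  linarith

/-- The counterpart of `thermalGap_le`, from the concave function on `(0, hi]`. -/
theorem le_thermalGap {hi x y s : ℝ} (hx0 : 0 < x) (hy0 : 0 < y) (hx : x ≤ hi) (hy : y ≤ hi)
    (hs : s ∈ Set.Icc (0 : ℝ) 1) :
    s * (1 - s) * (x - y) ^ 2 / (8 * Real.sinh (hi / 2) ^ 2) ≤ thermalGap x y s := by
  have hhi := sinh_half_pos (hx0.trans_le hx)
  set C := 1 / (4 * Real.sinh (hi / 2) ^ 2) with hC
  have hint : interior (Set.Ioc 0 hi) = Set.Ioo 0 hi := interior_Ioc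
  have hconc : ConcaveOn ℝ (Set.Ioc 0 hi)
      (fun z => Real.log (Real.sinh (z / 2)) + C / 2 * z ^ 2) := by
    refine concaveOn_of_hasDerivWithinAt2_nonpos (convex_Ioc 0 hi)
      (f' := fun z => Real.cosh (z / 2) / Real.sinh (z / 2) / 2 + C * z)
      (f'' := fun z => -(1 / (4 * Real.sinh (z / 2) ^ 2)) + C) ?_ ?_ ?_ ?_
    · intro z hz
      exact ((hasDerivAt_log_sinh_half hz.1).continuousAt.add (by fun_prop)).continuousWithinAt
    · intro z hz
      rw [hint] at hz
      have h1 : HasDerivAt (fun z : ℝ => C / 2 * z ^ 2) (C * z) z :=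
        ((hasDerivAt_pow 2 z).const_mul (C / 2)).congr_deriv (by push_cast; ring)
      exact ((hasDerivAt_log_sinh_half hz.1).add h1).hasDerivWithinAt
    · intro z hz
      rw [hint] at hz
      have h1 : HasDerivAt (fun z : ℝ => C * z) C z :=
        ((hasDerivAt_id z).const_mul C).congr_deriv (by ring)
      exact ((hasDerivAt_coth_half hz.1).add h1).hasDerivWithinAt
    · intro z hz
      rw [hint] at hz
      have h3 := sinh_half_pos hz.1
      have : C ≤ 1 / (4 * Real.sinh (z / 2) ^ 2) :=
        one_div_le_one_div_of_le (by positivity) (by linarith [sq_sinh_half_le hz.1 hz.2.le])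
      linarith
  have h := hconc.2 ⟨hx0, hx⟩ ⟨hy0, hy⟩ hs.1 (sub_nonneg.2 hs.2) (by ring)
  simp only [smul_eq_mul] at h
  have h2 : s * (1 - s) * (x - y) ^ 2 / (8 * Real.sinh (hi / 2) ^ 2)
      = C / 2 * (s * x ^ 2 + (1 - s) * y ^ 2 - (s * x + (1 - s) * y) ^ 2) := by
    rw [hC]
    field_simp
    ring
  rw [h2, thermalGap]
  linarith

theorem tanh_le_tanh {x y : ℝ} (h : x ≤ y) : Real.tanh x ≤ Real.tanh y := by
  rw [Real.tanh_eq_sinh_div_cosh, Real.tanh_eq_sinh_div_cosh,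
    div_le_div_iff₀ (Real.cosh_pos x) (Real.cosh_pos y)]
  have h1 := Real.sinh_sub y x
  have h2 := Real.sinh_nonneg_iff.2 (sub_nonneg.2 h)
  linarith

theorem sinh_mul_sinh_le (a b : ℝ) :
    Real.sinh a * Real.sinh b ≤ Real.sinh ((a + b) / 2) ^ 2 := by
  have h1 := Real.cosh_add a b
  have h2 := Real.cosh_sub a b
  have h3 := cosh_eq_two_mul (a + b)
  have h4 := Real.one_le_cosh (a - b)
  nlinarith

namespace ModeFrame

/-- The thermal, the squeezing and the displacement term. -/
theorem neg_log_chernoffValue (F G : ModeFrame) {β₀ β₁ s : ℝ} (hβ₀ : 0 < β₀) (hβ₁ : 0 < β₁)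
    (hs : s ∈ Set.Icc (0 : ℝ) 1) :
    -Real.log (F.chernoffValue G β₀ β₁ s) = thermalGap β₀ β₁ s +
      Real.log (1 + F.mismatch G * Real.sinh (s * β₀) * Real.sinh ((1 - s) * β₁) /
        (4 * Real.sinh ((s * β₀ + (1 - s) * β₁) / 2) ^ 2)) / 2 +
      F.overlapExponent G (s * β₀) ((1 - s) * β₁) := by
  have h1 := F.overlapDet_pos G hβ₀ hβ₁ hs
  have h2 := sinh_half_pos hβ₀
  have h3 := sinh_half_pos hβ₁
  have h4 := sinh_half_pos (convexComb_pos hβ₀ hβ₁ hs)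
  have h5 : F.overlapDet G (s * β₀) ((1 - s) * β₁) =
      Real.sinh ((s * β₀ + (1 - s) * β₁) / 2) ^ 2 *
      (1 + F.mismatch G * Real.sinh (s * β₀) * Real.sinh ((1 - s) * β₁) /
        (4 * Real.sinh ((s * β₀ + (1 - s) * β₁) / 2) ^ 2)) := by
    rw [overlapDet]
    field_simp
  have h6 : 0 < 1 + F.mismatch G * Real.sinh (s * β₀) * Real.sinh ((1 - s) * β₁) /
        (4 * Real.sinh ((s * β₀ + (1 - s) * β₁) / 2) ^ 2) := by
    rw [h5] at h1
    exact (mul_pos_iff_of_pos_left (by positivity)).1 h1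
  rw [chernoffValue, Real.log_mul (by positivity) (by positivity),
    Real.log_mul (by positivity) (by positivity), Real.log_mul (by positivity) (by positivity),
    Real.log_exp, Real.log_inv, Real.log_mul (by positivity) (by positivity),
    Real.log_sqrt h1.le, h5, Real.log_mul (by positivity) h6.ne', Real.log_pow,
    Real.log_rpow (by positivity), Real.log_rpow (by positivity),
    Real.log_mul (by positivity) (by positivity), Real.log_mul (by positivity) (by positivity),
    thermalGap]
  push_cast
  ring

/-- Uniformly in the exponent, since `sinh a * sinh b ≤ sinh² ((a + b) / 2)`. -/
theorem squeezing_term_le (F G : ModeFrame) {a b : ℝ} (ha : 0 ≤ a) (hb : 0 ≤ b)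
    (hab : 0 < a + b) :
    Real.log (1 + F.mismatch G * Real.sinh a * Real.sinh b / (4 * Real.sinh ((a + b) / 2) ^ 2)) / 2
      ≤ F.mismatch G / 8 := by
  have h1 := Real.sinh_nonneg_iff.2 ha
  have h2 := Real.sinh_nonneg_iff.2 hb
  have h3 := F.mismatch_nonneg G
  have h4 := sinh_half_pos hab
  have h5 : F.mismatch G * Real.sinh a * Real.sinh b / (4 * Real.sinh ((a + b) / 2) ^ 2)
      ≤ F.mismatch G / 4 := by
    rw [div_le_div_iff₀ (by positivity) (by norm_num), mul_assoc (F.mismatch G)]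
    nlinarith [mul_le_mul_of_nonneg_left (sinh_mul_sinh_le a b) h3]
  have h6 : 0 ≤ F.mismatch G * Real.sinh a * Real.sinh b / (4 * Real.sinh ((a + b) / 2) ^ 2) := by
    positivity
  have h7 := Real.log_le_sub_one_of_pos (lt_add_of_pos_of_le one_pos h6)
  linarith

/-- If the two forms agree, `overlapExponent` is at most
`sinh (a / 2) sinh (b / 2) / sinh ((a + b) / 2)` times their value, which for given `a + b`
is largest at `a = b`. -/
theorem displacement_term_le (F G : ModeFrame) {a b hi : ℝ} (ha : 0 ≤ a) (hb : 0 ≤ b)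
    (hab : 0 < a + b) (hhi : a + b ≤ hi) :
    F.overlapExponent G a b ≤ Real.tanh (hi / 4) / 2 * F.quad (F.pos - G.pos) (F.mom - G.mom) +
      |G.quad (F.pos - G.pos) (F.mom - G.mom) - F.quad (F.pos - G.pos) (F.mom - G.mom)| := by
  set P := F.quad (F.pos - G.pos) (F.mom - G.mom) with hP
  set R := G.quad (F.pos - G.pos) (F.mom - G.mom) with hR
  have hP0 : 0 ≤ P := F.quad_nonneg _ _
  have hR0 : 0 ≤ R := G.quad_nonneg _ _
  have hV := F.sinh_half_sq_le_overlapDet G ha hb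
  have hZ := sinh_half_pos hab
  have hsa := Real.sinh_nonneg_iff.2 (show 0 ≤ a / 2 by linarith)
  have hsb := Real.sinh_nonneg_iff.2 (show 0 ≤ b / 2 by linarith)
  have hca := Real.cosh_pos (a / 2)
  have hcb := Real.cosh_pos (b / 2)
  have hsqa := Real.cosh_sq (a / 2)
  have hZe : Real.sinh ((a + b) / 2) = Real.sinh (a / 2) * Real.cosh (b / 2)
      + Real.cosh (a / 2) * Real.sinh (b / 2) := by
    rw [add_div, Real.sinh_add]
  -- with `overlapDet` replaced by its lower bound, split off the difference of the two forms
  have h1 : F.overlapExponent G a b ≤ (Real.sinh a * Real.sinh (b / 2) ^ 2 * P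
      + Real.sinh b * Real.sinh (a / 2) ^ 2 * R) / (2 * Real.sinh ((a + b) / 2) ^ 2) := by
    have := Real.sinh_nonneg_iff.2 ha
    have := Real.sinh_nonneg_iff.2 hb
    exact div_le_div_of_nonneg_left (by positivity) (by positivity) (by linarith)
  have h2 : (Real.sinh a * Real.sinh (b / 2) ^ 2 * P + Real.sinh b * Real.sinh (a / 2) ^ 2 * R) /
      (2 * Real.sinh ((a + b) / 2) ^ 2) =
      Real.sinh (a / 2) * Real.sinh (b / 2) / Real.sinh ((a + b) / 2) * P +
        Real.sinh (a / 2) ^ 2 * Real.sinh (b / 2) * Real.cosh (b / 2) /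
          Real.sinh ((a + b) / 2) ^ 2 * (R - P) := by
    have : Real.sinh a * Real.sinh (b / 2) ^ 2 * P + Real.sinh b * Real.sinh (a / 2) ^ 2 * R =
        2 * (Real.sinh (a / 2) * Real.sinh (b / 2) * Real.sinh ((a + b) / 2) * P +
        Real.sinh (a / 2) ^ 2 * Real.sinh (b / 2) * Real.cosh (b / 2) * (R - P)) := by
      rw [hZe, sinh_eq_two_mul a, sinh_eq_two_mul b]
      ring
    rw [this]
    field_simp
  have h3 : Real.sinh (a / 2) * Real.sinh (b / 2) / Real.sinh ((a + b) / 2)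
      ≤ Real.tanh (hi / 4) / 2 := by
    have h4 : Real.sinh (a / 2) * Real.sinh (b / 2) ≤ Real.sinh ((a + b) / 4) ^ 2 := by
      have := sinh_mul_sinh_le (a / 2) (b / 2)
      rwa [show (a / 2 + b / 2) / 2 = (a + b) / 4 by ring] at this
    have h5 : Real.sinh ((a + b) / 2) = 2 * Real.sinh ((a + b) / 4) * Real.cosh ((a + b) / 4) := by
      rw [sinh_eq_two_mul, show (a + b) / 2 / 2 = (a + b) / 4 by ring]
    have h6 : 0 < Real.sinh ((a + b) / 4) := Real.sinh_pos_iff.2 (by linarith)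
    have h7 := Real.cosh_pos ((a + b) / 4)
    have h8 : Real.tanh ((a + b) / 4) ≤ Real.tanh (hi / 4) :=
      tanh_le_tanh (by linarith)
    calc _ ≤ Real.sinh ((a + b) / 4) ^ 2 / Real.sinh ((a + b) / 2) := by gcongr
      _ = Real.tanh ((a + b) / 4) / 2 := by
        rw [h5, Real.tanh_eq_sinh_div_cosh]
        field_simp
      _ ≤ _ := by linarith
  have h4 : Real.sinh (a / 2) ^ 2 * Real.sinh (b / 2) * Real.cosh (b / 2) /
      Real.sinh ((a + b) / 2) ^ 2 ≤ 1 := by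
    rw [div_le_one (by positivity), hZe]
    have hsc : Real.sinh (a / 2) ≤ Real.cosh (a / 2) := (Real.sinh_lt_cosh _).le
    have h9 : Real.sinh (a / 2) ^ 2 * Real.sinh (b / 2) * Real.cosh (b / 2) ≤
        Real.sinh (a / 2) * Real.cosh (a / 2) * (Real.sinh (b / 2) * Real.cosh (b / 2)) := by
      have : 0 ≤ Real.sinh (a / 2) * (Real.sinh (b / 2) * Real.cosh (b / 2)) := by positivity
      nlinarith
    nlinarith [sq_nonneg (Real.sinh (a / 2) * Real.cosh (b / 2)),
      sq_nonneg (Real.cosh (a / 2) * Real.sinh (b / 2)),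
      mul_nonneg (mul_nonneg hsa hca.le) (mul_nonneg hsb hcb.le)]
  rw [h2] at h1
  refine h1.trans (add_le_add (mul_le_mul_of_nonneg_right h3 hP0) ?_)
  refine (mul_le_mul_of_nonneg_left (le_abs_self _) (by positivity)).trans ?_
  exact mul_le_of_le_one_left (abs_nonneg _) h4

/-- The upper bound for the Chernoff information, uniform in the exponent `s`. -/
theorem neg_log_chernoffValue_le (F G : ModeFrame) {β₀ β₁ lo hi s : ℝ} (hlo : 0 < lo)
    (h0lo : lo ≤ β₀) (h1lo : lo ≤ β₁) (h0hi : β₀ ≤ hi) (h1hi : β₁ ≤ hi)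
    (hs : s ∈ Set.Icc (0 : ℝ) 1) :
    -Real.log (F.chernoffValue G β₀ β₁ s) ≤ (β₀ - β₁) ^ 2 / (32 * Real.sinh (lo / 2) ^ 2) +
      F.mismatch G / 8 + (Real.tanh (hi / 4) / 2 * F.quad (F.pos - G.pos) (F.mom - G.mom) +
      |G.quad (F.pos - G.pos) (F.mom - G.mom) - F.quad (F.pos - G.pos) (F.mom - G.mom)|) := by
  have hβ₀ := hlo.trans_le h0lo
  have hβ₁ := hlo.trans_le h1lo
  have hs' := sub_nonneg.2 hs.2
  have hsh := sinh_half_pos hlo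
  rw [F.neg_log_chernoffValue G hβ₀ hβ₁ hs]
  refine add_le_add (add_le_add ((thermalGap_le hlo h0lo h1lo hs).trans ?_)
    (F.squeezing_term_le G (mul_nonneg hs.1 hβ₀.le) (mul_nonneg hs' hβ₁.le)
      (convexComb_pos hβ₀ hβ₁ hs)))
    (F.displacement_term_le G (mul_nonneg hs.1 hβ₀.le) (mul_nonneg hs' hβ₁.le)
      (convexComb_pos hβ₀ hβ₁ hs) ?_)
  · rw [div_le_div_iff₀ (by positivity) (by positivity)]
    have h1 : s * (1 - s) ≤ 1 / 4 := by nlinarith [sq_nonneg (s - 1 / 2)]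
    have h2 : 0 ≤ (β₀ - β₁) ^ 2 * Real.sinh (lo / 2) ^ 2 := by positivity
    nlinarith [mul_le_mul_of_nonneg_right h1 h2]
  · have h1 := mul_le_mul_of_nonneg_left h0hi hs.1
    have h2 := mul_le_mul_of_nonneg_left h1hi hs'
    linarith

/-- The lower bound for the Chernoff information, obtained from the exponent `1 / 2`. -/
theorem le_neg_log_chernoffValue_half (F G : ModeFrame) {β₀ β₁ hi : ℝ} (hβ₀ : 0 < β₀)
    (hβ₁ : 0 < β₁) (h0hi : β₀ ≤ hi) (h1hi : β₁ ≤ hi) :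
    (β₀ - β₁) ^ 2 / (32 * Real.sinh (hi / 2) ^ 2) +
      F.mismatch G * (Real.sinh (β₀ / 2) * Real.sinh (β₁ / 2) /
        (8 * F.overlapDet G (β₀ / 2) (β₁ / 2))) +
      F.overlapExponent G (β₀ / 2) (β₁ / 2) ≤ -Real.log (F.chernoffValue G β₀ β₁ (1 / 2)) := by
  have hs : (1 / 2 : ℝ) ∈ Set.Icc (0 : ℝ) 1 := by constructor <;> norm_num
  have h0 := F.overlapDet_pos G hβ₀ hβ₁ hs
  have h1 := sinh_half_pos (convexComb_pos hβ₀ hβ₁ hs)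
  have h2 := F.mismatch_nonneg G
  have h3 := sinh_half_pos hβ₀
  have h4 := sinh_half_pos hβ₁
  rw [F.neg_log_chernoffValue G hβ₀ hβ₁ hs]
  have e0 : 1 / 2 * β₀ = β₀ / 2 := by ring
  have e1 : (1 - 1 / 2) * β₁ = β₁ / 2 := by ring
  rw [e0, e1] at h0 h1 ⊢
  refine add_le_add (add_le_add (le_trans (le_of_eq ?_) (le_thermalGap hβ₀ hβ₁ h0hi h1hi hs)) ?_)
    le_rfl
  · have := sinh_half_pos (hβ₀.trans_le h0hi)
    field_simp
    ring
  · have h5 := Real.one_sub_inv_le_log_of_pos (x := 1 + F.mismatch G * Real.sinh (β₀ / 2) *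
      Real.sinh (β₁ / 2) / (4 * Real.sinh ((β₀ / 2 + β₁ / 2) / 2) ^ 2)) (by positivity)
    have h6 : 1 - (1 + F.mismatch G * Real.sinh (β₀ / 2) *
      Real.sinh (β₁ / 2) / (4 * Real.sinh ((β₀ / 2 + β₁ / 2) / 2) ^ 2))⁻¹ =
      2 * (F.mismatch G * (Real.sinh (β₀ / 2) * Real.sinh (β₁ / 2) /
        (8 * F.overlapDet G (β₀ / 2) (β₁ / 2)))) := by
      have h7 : 1 + F.mismatch G * Real.sinh (β₀ / 2) *
        Real.sinh (β₁ / 2) / (4 * Real.sinh ((β₀ / 2 + β₁ / 2) / 2) ^ 2) =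
        F.overlapDet G (β₀ / 2) (β₁ / 2) / Real.sinh ((β₀ / 2 + β₁ / 2) / 2) ^ 2 := by
        rw [overlapDet]
        field_simp
      have h8 : F.overlapDet G (β₀ / 2) (β₁ / 2) - Real.sinh ((β₀ / 2 + β₁ / 2) / 2) ^ 2 =
          F.mismatch G * Real.sinh (β₀ / 2) * Real.sinh (β₁ / 2) / 4 := by
        rw [overlapDet]
        ring
      rw [h7, inv_div, one_sub_div h0.ne', h8]
      field_simp
      ring
    linarith

end ModeFrame

/-! ### Second order expansions at the origin -/

/-- `f` agrees with `q` up to terms of higher than second order, and `q` is itself of second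
order. -/
structure HasQuadExpansion {n : ℕ} (f q : (Fin n → ℝ) → ℝ) : Prop where
  isBigO : q =O[𝓝 0] fun h => ‖h‖ ^ 2
  isLittleO : (fun h => f h - q h) =o[𝓝 0] fun h => ‖h‖ ^ 2

namespace HasQuadExpansion

variable {n : ℕ} {f g q r : (Fin n → ℝ) → ℝ}

theorem monomial (i j : Fin n) :
    HasQuadExpansion (fun h : Fin n → ℝ => h i * h j) fun h => h i * h j := by
  refine ⟨IsBigO.of_bound 1 (Eventually.of_forall fun h => ?_), by simp⟩
  rw [norm_mul, one_mul, norm_pow, norm_norm, sq]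
  exact mul_le_mul (norm_le_pi_norm h i) (norm_le_pi_norm h j) (norm_nonneg _) (norm_nonneg _)

theorem add (hf : HasQuadExpansion f q) (hg : HasQuadExpansion g r) :
    HasQuadExpansion (fun h => f h + g h) fun h => q h + r h := by
  refine ⟨hf.isBigO.add hg.isBigO, (hf.isLittleO.add hg.isLittleO).congr_left fun h => ?_⟩
  ring

theorem mul_continuousAt (hf : HasQuadExpansion f q) {c : (Fin n → ℝ) → ℝ}
    (hc : ContinuousAt c 0) : HasQuadExpansion (fun h => c h * f h) fun h => c 0 * q h := by
  refine ⟨hf.isBigO.const_mul_left _, ?_⟩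
  have h1 : (fun h => c h * (f h - q h)) =o[𝓝 0] fun h : Fin n → ℝ => ‖h‖ ^ 2 := by
    simpa using (hc.isBigO_one ℝ).mul_isLittleO hf.isLittleO
  have h2 : (fun h => (c h - c 0) * q h) =o[𝓝 0] fun h : Fin n → ℝ => ‖h‖ ^ 2 := by
    have h3 : (fun h => c h - c 0) =o[𝓝 0] fun _ : Fin n → ℝ => (1 : ℝ) := by
      rw [isLittleO_one_iff]
      simpa using hc.tendsto.sub_const (c 0)
    simpa using h3.mul_isBigO hf.isBigO
  refine (h1.add h2).congr_left fun h => ?_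
  ring

theorem congr (hf : HasQuadExpansion f q) (hfg : ∀ h, f h = g h) (hqr : ∀ h, q h = r h) :
    HasQuadExpansion g r := by
  rwa [← funext hfg, ← funext hqr]

/-- The absolute value of a remainder is a remainder. -/
theorem abs_remainder (hf : HasQuadExpansion f fun _ => 0) :
    HasQuadExpansion (fun h => |f h|) fun _ => 0 := by
  refine ⟨isBigO_zero _ _, ?_⟩
  have h1 := hf.isLittleO
  simp only [sub_zero] at h1 ⊢
  exact h1.norm_left

/-- The squeeze principle for second order expansions. -/
theorem of_le_of_le {d : (Fin n → ℝ) → ℝ} (hf : HasQuadExpansion f q) (hg : HasQuadExpansion g q)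
    (hfd : ∀ᶠ h in 𝓝 0, f h ≤ d h) (hdg : ∀ᶠ h in 𝓝 0, d h ≤ g h) : HasQuadExpansion d q := by
  refine ⟨hf.isBigO, ?_⟩
  have h1 := hf.isLittleO.norm_left.add hg.isLittleO.norm_left
  refine IsBigO.trans_isLittleO (IsBigO.of_bound 1 ?_) h1
  filter_upwards [hfd, hdg] with h hh1 hh2
  simp only [Real.norm_eq_abs, one_mul]
  rw [abs_of_nonneg (a := |f h - q h| + |g h - q h|)
    (add_nonneg (abs_nonneg _) (abs_nonneg _)), abs_le]
  constructor
  · have := neg_abs_le (f h - q h)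
    have := abs_nonneg (g h - q h)
    linarith
  · have := le_abs_self (g h - q h)
    have := abs_nonneg (f h - q h)
    linarith

/-- `1 - exp (-d)` has the same second order expansion as `d`. -/
theorem one_sub_exp_neg {d : (Fin n → ℝ) → ℝ} (hd : HasQuadExpansion d q) :
    HasQuadExpansion (fun h => 1 - Real.exp (-d h)) q := by
  refine ⟨hd.isBigO, ?_⟩
  have hO : d =O[𝓝 0] fun h => ‖h‖ ^ 2 := by
    refine (hd.isLittleO.isBigO.add hd.isBigO).congr_left fun h => ?_
    ring
  have hnorm : Tendsto (fun h : Fin n → ℝ => ‖h‖ ^ 2) (𝓝 0) (𝓝 0) := by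
    have : Continuous fun h : Fin n → ℝ => ‖h‖ ^ 2 := by fun_prop
    simpa using this.tendsto 0
  have hd0 : Tendsto d (𝓝 0) (𝓝 0) := hO.trans_tendsto hnorm
  have hsq : (fun h => d h * d h) =o[𝓝 0] fun h => ‖h‖ ^ 2 := by
    simpa using ((isLittleO_one_iff ℝ).2 hd0).mul_isBigO hO
  have h1 : (fun h => 1 - Real.exp (-d h) - d h) =o[𝓝 0] fun h => ‖h‖ ^ 2 := by
    refine IsBigO.trans_isLittleO (IsBigO.of_bound 1 ?_) hsq
    filter_upwards [hd0.eventually (Metric.ball_mem_nhds 0 one_pos)] with h hh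
    have h2 : |-d h| ≤ 1 := by
      rw [abs_neg]
      simpa using (Metric.mem_ball.1 hh).le
    have h3 := Real.abs_exp_sub_one_sub_id_le h2
    rw [Real.norm_eq_abs, Real.norm_eq_abs, one_mul, abs_mul_self, ← abs_neg]
    convert h3 using 2 <;> ring
  refine (h1.add hd.isLittleO).congr_left fun h => ?_
  ring

end HasQuadExpansion

/-! ### The overlap of two Gaussian states in squeezing coordinates -/

namespace ModeFrame

theorem one_add_sq_ofParam (r φ : ℝ) :
    1 + (Real.sinh (2 * r) * Real.sin (2 * φ)) ^ 2 =
      (Real.cosh (2 * r) + Real.sinh (2 * r) * Real.cos (2 * φ)) *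
      (Real.cosh (2 * r) - Real.sinh (2 * r) * Real.cos (2 * φ)) := by
  have h1 := Real.cosh_sq (2 * r)
  have h2 := Real.sin_sq_add_cos_sq (2 * φ)
  linear_combination (Real.sinh (2 * r)) ^ 2 * h2 - h1

theorem quad_ofParam (r φ q p x y : ℝ) : (ofParam r φ q p).quad x y =
    (Real.cosh (2 * r) - Real.sinh (2 * r) * Real.cos (2 * φ)) * (x * x)
      + 2 * (Real.sinh (2 * r) * Real.sin (2 * φ)) * (x * y)
      + (Real.cosh (2 * r) + Real.sinh (2 * r) * Real.cos (2 * φ)) * (y * y) := by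
  have h0 := (ofParam r φ q p).width_pos
  have h1 := one_add_sq_ofParam r φ
  simp only [quad, ofParam] at h0 ⊢
  field_simp
  linear_combination x ^ 2 * h1

theorem mismatch_ofParam (r φ q p r' φ' q' p' : ℝ) :
    (ofParam r φ q p).mismatch (ofParam r' φ' q' p') =
      4 * (Real.sinh (r' - r) ^ 2
        + Real.sinh (2 * r) * Real.sinh (2 * r') * Real.sin (φ' - φ) ^ 2) := by
  have hm := (ofParam r φ q p).width_pos
  have hm' := (ofParam r' φ' q' p').width_pos
  have h1 := one_add_sq_ofParam r φ
  have h1' := one_add_sq_ofParam r' φ'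
  have h2 : 2 * Real.sinh (r' - r) ^ 2 + 1 = Real.cosh (2 * r') * Real.cosh (2 * r) -
      Real.sinh (2 * r') * Real.sinh (2 * r) := by
    rw [← Real.cosh_sub, ← mul_sub, Real.cosh_two_mul, Real.cosh_sq]
    ring
  have h3 : 1 - 2 * Real.sin (φ' - φ) ^ 2 = Real.cos (2 * φ') * Real.cos (2 * φ) +
      Real.sin (2 * φ') * Real.sin (2 * φ) := by
    rw [← Real.cos_sub, ← mul_sub, Real.cos_two_mul, Real.sin_sq]
    ring
  simp only [mismatch, ofParam] at hm hm' ⊢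
  generalize Real.cosh (2 * r) = c at *
  generalize Real.sinh (2 * r) = s at *
  generalize Real.cos (2 * φ) = C at *
  generalize Real.sin (2 * φ) = S at *
  generalize Real.cosh (2 * r') = c' at *
  generalize Real.sinh (2 * r') = s' at *
  generalize Real.cos (2 * φ') = C' at *
  generalize Real.sin (2 * φ') = S' at *
  have h4 : 4 * (Real.sinh (r' - r) ^ 2 + s * s' * Real.sin (φ' - φ) ^ 2) =
      (c + s * C) * (c' - s' * C') + (c' + s' * C') * (c - s * C)
        - 2 * (s * S) * (s' * S') - 2 := by
    linear_combination 2 * h2 - 2 * s * s' * h3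
  rw [h4]
  field_simp
  linear_combination (c' + s' * C') ^ 2 * h1 + (c + s * C) ^ 2 * h1'

end ModeFrame

/-! ### The expansion of the Chernoff information -/

/-- The frame labelled by a parameter point. -/
noncomputable def frameAt (θ : Fin 5 → ℝ) : ModeFrame :=
  ModeFrame.ofParam (θ 1) (θ 2) (θ 3) (θ 4)

theorem gaussianLineElement_eq (θ h : Fin 5 → ℝ) : gaussianLineElement θ h =
    1 / (32 * Real.sinh (θ 0 / 2) ^ 2) * (h 0 * h 0)
      + (h 1 * h 1 + Real.sinh (2 * θ 1) ^ 2 * (h 2 * h 2)) / 2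
      + Real.tanh (θ 0 / 4) / 2 * (frameAt θ).quad (h 3) (h 4) := by
  rw [frameAt, ModeFrame.quad_ofParam, gaussianLineElement]
  have h1 : Real.exp (-2 * θ 1) = Real.cosh (2 * θ 1) - Real.sinh (2 * θ 1) := by
    rw [Real.cosh_sub_sinh]
    congr 1
    ring
  have h2 : Real.exp (2 * θ 1) = Real.cosh (2 * θ 1) + Real.sinh (2 * θ 1) := by
    rw [Real.cosh_add_sinh]
  have h3 := Real.sin_sq_add_cos_sq (θ 2)
  simp only [rotatedDisplacement, rotMat, Matrix.vecMul, dotProduct, Fin.sum_univ_two,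
    Matrix.of_apply, Matrix.cons_val_zero, Matrix.cons_val_one]
  rw [h1, h2, Real.cos_two_mul, Real.sin_two_mul]
  have h4 : Real.sin (θ 2) ^ 2 = 1 - Real.cos (θ 2) ^ 2 := by linarith
  ring_nf
  rw [h4]
  ring

section expansion

variable (θ : Fin 5 → ℝ)

theorem hasQuadExpansion_quad_self :
    HasQuadExpansion (fun h : Fin 5 → ℝ => (frameAt θ).quad (h 3) (h 4))
      fun h => (frameAt θ).quad (h 3) (h 4) := by
  refine HasQuadExpansion.congr (((HasQuadExpansion.monomial (n := 5) 3 3).mul_continuousAt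
    (continuousAt_const (y := Real.cosh (2 * θ 1) - Real.sinh (2 * θ 1) * Real.cos (2 * θ 2)))).add
    ((HasQuadExpansion.monomial 3 4).mul_continuousAt
    (continuousAt_const (y := 2 * (Real.sinh (2 * θ 1) * Real.sin (2 * θ 2))))) |>.add
    ((HasQuadExpansion.monomial 4 4).mul_continuousAt
    (continuousAt_const (y := Real.cosh (2 * θ 1) + Real.sinh (2 * θ 1) * Real.cos (2 * θ 2)))))
    (fun h => ?_) (fun h => ?_) <;>
  rw [frameAt, ModeFrame.quad_ofParam]

theorem hasQuadExpansion_quad_add :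
    HasQuadExpansion (fun h => (frameAt (θ + h)).quad (h 3) (h 4))
      fun h => (frameAt θ).quad (h 3) (h 4) := by
  refine HasQuadExpansion.congr (((HasQuadExpansion.monomial 3 3).mul_continuousAt
    (c := fun h => Real.cosh (2 * (θ + h) 1) - Real.sinh (2 * (θ + h) 1) * Real.cos (2 * (θ + h) 2))
    (by fun_prop)).add ((HasQuadExpansion.monomial 3 4).mul_continuousAt
    (c := fun h => 2 * (Real.sinh (2 * (θ + h) 1) * Real.sin (2 * (θ + h) 2)))
    (by fun_prop)) |>.add ((HasQuadExpansion.monomial 4 4).mul_continuousAt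
    (c := fun h => Real.cosh (2 * (θ + h) 1) + Real.sinh (2 * (θ + h) 1) * Real.cos (2 * (θ + h) 2))
    (by fun_prop)))
    (fun h => ?_) (fun h => ?_) <;>
  simp only [frameAt, ModeFrame.quad_ofParam, add_zero]

theorem mul_dslope_sinh (x : ℝ) : x * dslope Real.sinh 0 x = Real.sinh x := by
  simpa using sub_smul_dslope Real.sinh 0 x

theorem mul_dslope_sin (x : ℝ) : x * dslope Real.sin 0 x = Real.sin x := by
  simpa using sub_smul_dslope Real.sin 0 x

/-- The quotients `sinh x / x` and `sin x / x`, continued to `x = 0` as `dslope`, turn the mismatch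
into a combination of monomials with continuous coefficients. -/
theorem hasQuadExpansion_mismatch :
    HasQuadExpansion (fun h => (frameAt θ).mismatch (frameAt (θ + h)))
      fun h => 4 * (h 1 * h 1 + Real.sinh (2 * θ 1) ^ 2 * (h 2 * h 2)) := by
  have hS : ContinuousAt (fun h : Fin 5 → ℝ => dslope Real.sinh 0 (h 1)) 0 := by
    refine ContinuousAt.comp (f := fun h : Fin 5 → ℝ => h 1) (g := dslope Real.sinh 0) ?_
      (continuous_apply 1).continuousAt
    exact continuousAt_dslope_same.2 Real.differentiable_sinh.differentiableAt
  have hs : ContinuousAt (fun h : Fin 5 → ℝ => dslope Real.sin 0 (h 2)) 0 := by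
    refine ContinuousAt.comp (f := fun h : Fin 5 → ℝ => h 2) (g := dslope Real.sin 0) ?_
      (continuous_apply 2).continuousAt
    exact continuousAt_dslope_same.2 Real.differentiable_sin.differentiableAt
  have h1 := (HasQuadExpansion.monomial (n := 5) 1 1).mul_continuousAt
    ((hS.pow 2).const_mul 4)
  have hc : ContinuousAt (fun h : Fin 5 → ℝ => 4 * (Real.sinh (2 * θ 1) *
      Real.sinh (2 * (θ + h) 1))) 0 := by fun_prop
  have h2 := (HasQuadExpansion.monomial (n := 5) 2 2).mul_continuousAt (hc.mul (hs.pow 2))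
  refine (h1.add h2).congr (fun h => ?_) (fun h => ?_)
  · rw [frameAt, frameAt, ModeFrame.mismatch_ofParam]
    simp only [Pi.add_apply, Pi.mul_apply, Pi.pow_apply, add_sub_cancel_left]
    rw [← mul_dslope_sinh (h 1), ← mul_dslope_sin (h 2)]
    ring
  · simp [dslope_same]
    ring

theorem continuousAt_mismatch :
    ContinuousAt (fun h => (frameAt θ).mismatch (frameAt (θ + h))) 0 := by
  simp only [frameAt, ModeFrame.mismatch_ofParam]
  fun_prop

theorem mismatch_self : (frameAt θ).mismatch (frameAt (θ + 0)) = 0 := by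
  simp [ModeFrame.mismatch]

theorem continuousAt_overlapDet :
    ContinuousAt (fun h => (frameAt θ).overlapDet (frameAt (θ + h)) (θ 0 / 2)
      ((θ + h) 0 / 2)) 0 := by
  have := continuousAt_mismatch θ
  unfold ModeFrame.overlapDet
  fun_prop

theorem overlapDet_self :
    (frameAt θ).overlapDet (frameAt (θ + 0)) (θ 0 / 2) ((θ + 0) 0 / 2) =
      Real.sinh (θ 0 / 2) ^ 2 := by
  rw [ModeFrame.overlapDet, mismatch_self, add_zero, add_halves]
  ring

/-- The bound for the Chernoff information from above. -/
noncomputable def upperBound (h : Fin 5 → ℝ) : ℝ :=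
  (θ 0 - (θ + h) 0) ^ 2 / (32 * Real.sinh ((θ 0 - |h 0|) / 2) ^ 2) +
    (frameAt θ).mismatch (frameAt (θ + h)) / 8 +
    (Real.tanh ((θ 0 + |h 0|) / 4) / 2 * (frameAt θ).quad (h 3) (h 4) +
      |(frameAt (θ + h)).quad (h 3) (h 4) - (frameAt θ).quad (h 3) (h 4)|)

/-- The bound for the Chernoff information from below. -/
noncomputable def lowerBound (h : Fin 5 → ℝ) : ℝ :=
  (θ 0 - (θ + h) 0) ^ 2 / (32 * Real.sinh ((θ 0 + |h 0|) / 2) ^ 2) +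
    (frameAt θ).mismatch (frameAt (θ + h)) * (Real.sinh (θ 0 / 2) * Real.sinh ((θ + h) 0 / 2) /
        (8 * (frameAt θ).overlapDet (frameAt (θ + h)) (θ 0 / 2) ((θ + h) 0 / 2))) +
    (frameAt θ).overlapExponent (frameAt (θ + h)) (θ 0 / 2) ((θ + h) 0 / 2)

variable {θ}

theorem hasQuadExpansion_thermal (hθ : 0 < θ 0) {c : (Fin 5 → ℝ) → ℝ} (hc : ContinuousAt c 0)
    (hc0 : c 0 = θ 0) :
    HasQuadExpansion (fun h => (θ 0 - (θ + h) 0) ^ 2 / (32 * Real.sinh (c h / 2) ^ 2))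
      fun h => 1 / (32 * Real.sinh (θ 0 / 2) ^ 2) * (h 0 * h 0) := by
  have hs := sinh_half_pos hθ
  have h1 : ContinuousAt (fun h => 1 / (32 * Real.sinh (c h / 2) ^ 2)) 0 := by
    refine ContinuousAt.div continuousAt_const (by fun_prop) ?_
    rw [hc0]
    positivity
  refine ((HasQuadExpansion.monomial 0 0).mul_continuousAt h1).congr (fun h => ?_) (fun h => ?_)
  · simp only [Pi.add_apply]
    ring
  · rw [hc0]

theorem continuous_abs_coord : Continuous fun h : Fin 5 → ℝ => |h 0| :=
  (continuous_apply 0).abs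

theorem hasQuadExpansion_upperBound (hθ : 0 < θ 0) :
    HasQuadExpansion (upperBound θ) (gaussianLineElement θ) := by
  have h1 := hasQuadExpansion_thermal hθ (c := fun h => θ 0 - |h 0|)
    (continuous_const.sub continuous_abs_coord).continuousAt (by simp)
  have h2 := (hasQuadExpansion_mismatch θ).mul_continuousAt (continuousAt_const (y := (1 / 8 : ℝ)))
  have hT : ContinuousAt (fun h : Fin 5 → ℝ => Real.tanh ((θ 0 + |h 0|) / 4) / 2) 0 := by
    simp only [Real.tanh_eq_sinh_div_cosh]
    have hc : Continuous fun h : Fin 5 → ℝ => (θ 0 + |h 0|) / 4 :=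
      (continuous_const.add continuous_abs_coord).div_const 4
    refine ContinuousAt.div_const (ContinuousAt.div (Real.continuous_sinh.comp hc).continuousAt
      (Real.continuous_cosh.comp hc).continuousAt ?_) _
    exact (Real.cosh_pos _).ne'
  have h3 := (hasQuadExpansion_quad_self θ).mul_continuousAt hT
  have h4 := ((hasQuadExpansion_quad_add θ).add ((hasQuadExpansion_quad_self θ).mul_continuousAt
    (continuousAt_const (y := (-1 : ℝ))))).congr (g := fun h =>
    (frameAt (θ + h)).quad (h 3) (h 4) - (frameAt θ).quad (h 3) (h 4)) (r := fun _ => 0)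
    (fun h => by ring) (fun h => by ring)
  refine ((h1.add h2).add (h3.add h4.abs_remainder)).congr (fun h => ?_) (fun h => ?_)
  · simp only [upperBound]
    ring
  · rw [gaussianLineElement_eq]
    simp only [Pi.zero_apply, abs_zero, add_zero]
    ring

theorem quad_neg (F : ModeFrame) (x y : ℝ) : F.quad (-x) (-y) = F.quad x y := by
  unfold ModeFrame.quad
  ring

theorem pos_sub_pos (θ h : Fin 5 → ℝ) : (frameAt θ).pos - (frameAt (θ + h)).pos = -h 3 := by
  simp [frameAt, ModeFrame.ofParam]

theorem mom_sub_mom (θ h : Fin 5 → ℝ) : (frameAt θ).mom - (frameAt (θ + h)).mom = -h 4 := by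
  simp [frameAt, ModeFrame.ofParam]

theorem hasQuadExpansion_lowerBound (hθ : 0 < θ 0) :
    HasQuadExpansion (lowerBound θ) (gaussianLineElement θ) := by
  have hs := sinh_half_pos hθ
  have hV := continuousAt_overlapDet θ
  have hV0 := overlapDet_self θ
  have hVne : ∀ c : ℝ, 0 < c → c * (frameAt θ).overlapDet (frameAt (θ + 0)) (θ 0 / 2)
      ((θ + 0) 0 / 2) ≠ 0 := by
    intro c hc
    rw [hV0]
    positivity
  have h1 := hasQuadExpansion_thermal hθ (c := fun h => θ 0 + |h 0|)
    (continuous_const.add continuous_abs_coord).continuousAt (by simp)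
  have hk : ContinuousAt (fun h : Fin 5 → ℝ => Real.sinh (θ 0 / 2) * Real.sinh ((θ + h) 0 / 2) /
        (8 * (frameAt θ).overlapDet (frameAt (θ + h)) (θ 0 / 2) ((θ + h) 0 / 2))) 0 :=
    ContinuousAt.div (by fun_prop) (by fun_prop) (hVne 8 (by norm_num))
  have h2 := (hasQuadExpansion_mismatch θ).mul_continuousAt hk
  have he : ContinuousAt (fun h : Fin 5 → ℝ => Real.sinh (θ 0 / 2) *
      Real.sinh ((θ + h) 0 / 2 / 2) ^ 2 /
        (2 * (frameAt θ).overlapDet (frameAt (θ + h)) (θ 0 / 2) ((θ + h) 0 / 2))) 0 :=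
    ContinuousAt.div (by fun_prop) (by fun_prop) (hVne 2 (by norm_num))
  have he' : ContinuousAt (fun h : Fin 5 → ℝ => Real.sinh ((θ + h) 0 / 2) *
      Real.sinh (θ 0 / 2 / 2) ^ 2 /
        (2 * (frameAt θ).overlapDet (frameAt (θ + h)) (θ 0 / 2) ((θ + h) 0 / 2))) 0 :=
    ContinuousAt.div (by fun_prop) (by fun_prop) (hVne 2 (by norm_num))
  have h3 := ((hasQuadExpansion_quad_self θ).mul_continuousAt he).add
    ((hasQuadExpansion_quad_add θ).mul_continuousAt he')
  refine ((h1.add h2).add h3).congr (fun h => ?_) (fun h => ?_)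
  · rw [lowerBound, ModeFrame.overlapExponent, pos_sub_pos, mom_sub_mom, quad_neg, quad_neg]
    ring
  · rw [gaussianLineElement_eq, hV0, add_zero]
    have h5 : Real.tanh (θ 0 / 4) = Real.sinh (θ 0 / 2 / 2) ^ 2 * 2 / Real.sinh (θ 0 / 2) := by
      have h6 : 0 < Real.sinh (θ 0 / 2 / 2) := Real.sinh_pos_iff.2 (by linarith)
      have h7 := Real.cosh_pos (θ 0 / 2 / 2)
      rw [sinh_eq_two_mul (θ 0 / 2), Real.tanh_eq_sinh_div_cosh,
        show θ 0 / 4 = θ 0 / 2 / 2 by ring]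
      field_simp
    rw [h5]
    field_simp
    ring

end expansion

theorem hasQuadExpansion_chernoffInformation {θ : Fin 5 → ℝ} (hθ : 0 < θ 0) :
    HasQuadExpansion (fun h => chernoffInformation ((frameAt θ).state (θ 0))
      ((frameAt (θ + h)).state ((θ + h) 0))) (gaussianLineElement θ) := by
  have hnear : ∀ᶠ h : Fin 5 → ℝ in 𝓝 0, |h 0| < θ 0 := by
    exact continuous_abs_coord.continuousAt.tendsto.eventually
      (gt_mem_nhds (by simpa using hθ))
  refine HasQuadExpansion.of_le_of_le (hasQuadExpansion_lowerBound hθ)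
    (hasQuadExpansion_upperBound hθ) ?_ ?_
  · filter_upwards [hnear] with h hh
    have h1 := neg_abs_le (h 0)
    have h2 := le_abs_self (h 0)
    have h3 := abs_nonneg (h 0)
    have hpos : 0 < (θ + h) 0 := by
      rw [Pi.add_apply]
      linarith
    obtain ⟨s, hs, hmax, hD, -⟩ := (frameAt θ).exists_chernoff_eq (frameAt (θ + h)) hθ hpos
    rw [hD]
    refine le_trans ?_ (hmax (1 / 2) (by constructor <;> norm_num))
    exact (frameAt θ).le_neg_log_chernoffValue_half (frameAt (θ + h)) hθ hpos (by linarith)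
      (by rw [Pi.add_apply]; linarith)
  · filter_upwards [hnear] with h hh
    have h1 := neg_abs_le (h 0)
    have h2 := le_abs_self (h 0)
    have h3 := abs_nonneg (h 0)
    have hpos : 0 < (θ + h) 0 := by
      rw [Pi.add_apply]
      linarith
    obtain ⟨s, hs, -, hD, -⟩ := (frameAt θ).exists_chernoff_eq (frameAt (θ + h)) hθ hpos
    rw [hD]
    refine ((frameAt θ).neg_log_chernoffValue_le (frameAt (θ + h)) (lo := θ 0 - |h 0|)
      (hi := θ 0 + |h 0|) (by linarith) (by linarith) (by rw [Pi.add_apply]; linarith)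
      (by linarith) (by rw [Pi.add_apply]; linarith) hs).trans (le_of_eq ?_)
    rw [pos_sub_pos, mom_sub_mom, quad_neg, quad_neg, upperBound]

/-! ### The metric tensor -/

/-- The matrix of the line element in the coordinates `(β, r, φ, q, p)`. -/
noncomputable def gaussianMetric (θ : Fin 5 → ℝ) : Matrix (Fin 5) (Fin 5) ℝ :=
  !![1 / (32 * Real.sinh (θ 0 / 2) ^ 2), 0, 0, 0, 0;
    0, 1 / 2, 0, 0, 0;
    0, 0, Real.sinh (2 * θ 1) ^ 2 / 2, 0, 0;
    0, 0, 0, Real.tanh (θ 0 / 4) / 2 *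
        (Real.cosh (2 * θ 1) - Real.sinh (2 * θ 1) * Real.cos (2 * θ 2)),
      Real.tanh (θ 0 / 4) / 2 * (Real.sinh (2 * θ 1) * Real.sin (2 * θ 2));
    0, 0, 0, Real.tanh (θ 0 / 4) / 2 * (Real.sinh (2 * θ 1) * Real.sin (2 * θ 2)),
      Real.tanh (θ 0 / 4) / 2 *
        (Real.cosh (2 * θ 1) + Real.sinh (2 * θ 1) * Real.cos (2 * θ 2))]

theorem isSymm_gaussianMetric (θ : Fin 5 → ℝ) : (gaussianMetric θ).IsSymm := by
  ext i j
  fin_cases i <;> fin_cases j <;> rfl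

theorem dotProduct_gaussianMetric (θ h : Fin 5 → ℝ) :
    h ⬝ᵥ (gaussianMetric θ *ᵥ h) = gaussianLineElement θ h := by
  rw [gaussianLineElement_eq, frameAt, ModeFrame.quad_ofParam]
  simp [gaussianMetric, Matrix.mulVec, dotProduct, Fin.sum_univ_five]
  ring

theorem det_gaussianMetric (θ : Fin 5 → ℝ) : (gaussianMetric θ).det =
    Real.tanh (θ 0 / 4) ^ 2 * Real.sinh (2 * θ 1) ^ 2 / (512 * Real.sinh (θ 0 / 2) ^ 2) := by
  have h1 := ModeFrame.one_add_sq_ofParam (θ 1) (θ 2)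
  simp [gaussianMetric, Matrix.det_succ_row_zero, Fin.sum_univ_succ, Fin.succAbove]
  linear_combination (-(Real.tanh (θ 0 / 4) ^ 2 * Real.sinh (2 * θ 1) ^ 2 /
    (512 * Real.sinh (θ 0 / 2) ^ 2))) * h1

theorem jeffreysDensity_gaussianMetric {θ : Fin 5 → ℝ} (hθ : 0 < θ 0) :
    jeffreysDensity (gaussianMetric θ) =
      1 / (16 * Real.sqrt 2) * (Real.tanh (θ 0 / 4) / Real.sinh (θ 0 / 2))
        * |Real.sinh (2 * θ 1)| := by
  have hs := sinh_half_pos hθ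
  have hT : 0 < Real.tanh (θ 0 / 4) := by
    have := tanh_half_pos (t := θ 0 / 2) (by linarith)
    rwa [show θ 0 / 2 / 2 = θ 0 / 4 by ring] at this
  rw [jeffreysDensity, det_gaussianMetric, abs_of_nonneg (by positivity),
    Real.sqrt_eq_iff_eq_sq (by positivity) (by positivity), mul_pow, mul_pow, div_pow, mul_pow,
    Real.sq_sqrt (by norm_num), sq_abs, div_pow]
  field_simp
  ring

end QuantumChernoff

theorem mainTheorem8 :
    -- every parameter point labels exactly one Gaussian state
    (∀ θ : Fin 5 → ℝ, 0 < θ 0 →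
      ∃! ρ : ModeSpace →L[ℂ] ModeSpace, IsGaussianStateAt ρ θ) ∧
    ∀ ρ : (Fin 5 → ℝ) → (ModeSpace →L[ℂ] ModeSpace),
      (∀ θ, 0 < θ 0 → IsGaussianStateAt (ρ θ) θ) →
      -- the traces defining the Chernoff information exist and are positive, the minimum is attained
      (∀ θ₀ θ₁ : Fin 5 → ℝ, 0 < θ₀ 0 → 0 < θ₁ 0 →
        (∀ s ∈ Set.Icc (0 : ℝ) 1, ∃ t : ℝ, 0 < t ∧
          HasTrace (chernoffProduct (ρ θ₀) (ρ θ₁) s) (t : ℂ)) ∧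
        ∃ s ∈ Set.Icc (0 : ℝ) 1,
          IsMinOn (fun s => chernoffTrace (ρ θ₀) (ρ θ₁) s) (Set.Icc (0 : ℝ) 1) s) ∧
      -- the metric and its Jeffreys prior
      ∀ θ : Fin 5 → ℝ, 0 < θ 0 →
        ∃ g : Matrix (Fin 5) (Fin 5) ℝ,
          IsInducedMetric (fun θ₀ θ₁ => chernoffInformation (ρ θ₀) (ρ θ₁)) θ g ∧
          IsInducedMetric (fun θ₀ θ₁ => 1 - chernoffQ (ρ θ₀) (ρ θ₁)) θ g ∧
          (∀ h : Fin 5 → ℝ, h ⬝ᵥ (g *ᵥ h) = gaussianLineElement θ h) ∧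
          jeffreysDensity g =
            1 / (16 * Real.sqrt 2) * (Real.tanh (θ 0 / 4) / Real.sinh (θ 0 / 2))
              * |Real.sinh (2 * θ 1)| := by
  refine ⟨fun θ hθ => ⟨_, isGaussianStateAt_state θ hθ, fun ρ h => h.eq_state hθ⟩,
    fun ρ hρ => ⟨fun θ₀ θ₁ h₀ h₁ => ?_, fun θ hθ => ?_⟩⟩
  · rw [(hρ θ₀ h₀).eq_state h₀, (hρ θ₁ h₁).eq_state h₁]
    exact ⟨fun s hs => ⟨_, ModeFrame.chernoffValue_pos _ _ h₀ h₁ hs,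
      ModeFrame.hasTrace_chernoffProduct _ _ h₀ h₁ hs⟩,
      ModeFrame.exists_isMinOn_chernoffTrace _ _ h₀ h₁⟩
  · have hnear : ∀ᶠ h : Fin 5 → ℝ in 𝓝 0, 0 < (θ + h) 0 := by
      have : ContinuousAt (fun h : Fin 5 → ℝ => (θ + h) 0) 0 := by fun_prop
      exact this.tendsto.eventually (lt_mem_nhds (by simpa using hθ))
    have hstate : ∀ θ, 0 < θ 0 → ρ θ = (frameAt θ).state (θ 0) := fun θ hθ => (hρ θ hθ).eq_state hθ
    have hD := hasQuadExpansion_chernoffInformation hθ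
    refine ⟨gaussianMetric θ, ⟨isSymm_gaussianMetric θ, ?_⟩, ⟨isSymm_gaussianMetric θ, ?_⟩,
      dotProduct_gaussianMetric θ, jeffreysDensity_gaussianMetric hθ⟩
    · refine hD.isLittleO.congr' ?_ EventuallyEq.rfl
      filter_upwards [hnear] with h hh
      rw [hstate θ hθ, hstate (θ + h) hh, dotProduct_gaussianMetric]
    · refine hD.one_sub_exp_neg.isLittleO.congr' ?_ EventuallyEq.rfl
      filter_upwards [hnear] with h hh
      obtain ⟨-, -, -, -, hQ⟩ := (frameAt θ).exists_chernoff_eq (frameAt (θ + h)) hθ hh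
      rw [hstate θ hθ, hstate (θ + h) hh, dotProduct_gaussianMetric, hQ]
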